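/- Let $-\Delta$ be the Dirichlet Laplacian on the infinite chain of edges $[0,\pi/n]$, $n=1,2,3,\dots$, i.e. the operator $\bigoplus_n(-d^2/dx^2)$ in $\mathcal H=\bigoplus_{n\ge1}L^2[0,\pi/n]$ with domain $$\Big\{\psi\in\mathcal H:\ \psi_n\in H^2(0,\tfrac{\pi}{n}),\ \textstyle\sum_n\|\psi_n''\|^2<\infty,\ \psi_n(0)=\psi_n(\tfrac{\pi}{n})=0\ \text{for all } n\Big\}.$$ Let $d(n)$ be the number of divisors of $n$, let $B_k$ be the Bernoulli numbers, $\gamma$ Euler's constant and $\zeta$ the Riemann zeta function. For every $t>0$ the operator $e^{-t\sqrt{-\Delta}}$ is of trace class, and $$\Theta(t):=\operatorname{tr}\,e^{-t\sqrt{-\Delta}}=\sum_{n=1}^\infty d(n)e^{-nt},$$ the series being convergent. Moreover: 1. (Asymptotic expansion.) As $t\to0^+$, $$\Theta(t)\sim-\frac{\ln t}{t}+\frac{\gamma}{t}+\frac14+\sum_{m=1}^{\infty}\frac{B_{m+1}^2}{(m+1)(m+1)!}(-t)^m ,$$ that is, for every $N\ge0$ the difference of $\Theta(t)$ and the expansion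 truncated after $m=N$ is $o(t^N)$. 2. (Exact formula.) For every integer $N\ge1$, every real $\kappa$ with $-N-1<\kappa<-N$ and every $t>0$, $$\Theta(t)=-\frac{\ln t}{t}+\frac{\gamma}{t}+\frac14+\sum_{m=1}^{N}\frac{B_{m+1}^2}{(m+1)(m+1)!}(-t)^m+J_\kappa(t),\qquad J_\kappa(t):=\frac1{2\pi i}\int_{\kappa-i\infty}^{\kappa+i\infty}t^{-z}\,\Gamma(z)\,\zeta(z)^2\,dz,$$ where the integral converges absolutely. 3. (The remainder does not vanish.) For every $t>0$ and every sequence of real numbers $\kappa_j\to-\infty$ with $\kappa_j\notin\{0,-1,-2,\dots\}$, $J_{\kappa_j}(t)\not\to0$ as $j\to\infty$. 4. (Divergence.) The power series $\sum_{m\ge1}\frac{B_{m+1}^2}{(m+1)(m+1)!}(-z)^m$ has radius of convergence $0$: it diverges for every complex $z\ne0$. -/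

import Mathlib

open scoped Real Topology

noncomputable section

namespace DirichletGraph

/-- Lebesgue measure on the edge `[0, π / n]` of the graph, for `n = 1, 2, 3, …`. -/
def edgeMeasure (n : ℕ+) : MeasureTheory.Measure ℝ :=
  MeasureTheory.volume.restrict (Set.Icc (0 : ℝ) (π / (n : ℝ)))

/-- The Hilbert space of the graph: the `ℓ²` direct sum over `n = 1, 2, 3, …` of
`L²([0, π / n])`. -/
abbrev GraphL2 : Type :=
  lp (fun n : ℕ+ => MeasureTheory.Lp ℂ 2 (edgeMeasure n)) 2

/-- `IsDirichletLaplacian ψ φ` says that `ψ` lies in the domain of the Dirichlet Laplacian `Δ` of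
the graph and that `Δ ψ = φ`: every component `ψ n` is in `H²(0, π / n)`, with second weak
derivative `φ n`, and vanishes at both ends of the edge.

A function is in `H²(0, L)` with weak derivatives `v` and `w` in `L²` exactly when it is almost
everywhere equal to a function `u` with `u x = u 0 + ∫₀ˣ v` and `v x = v 0 + ∫₀ˣ w`; the boundary
values are those of the continuous representative `u`.  The finiteness of `‖Δ ψ‖` is contained in
`φ : GraphL2`. -/
def IsDirichletLaplacian (ψ φ : GraphL2) : Prop :=
  ∀ n : ℕ+, ∃ u v : ℝ → ℂ,
    (ψ n : ℝ → ℂ) =ᵐ[edgeMeasure n] u ∧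
    (∀ x ∈ Set.Icc (0 : ℝ) (π / (n : ℝ)), u x = u 0 + ∫ y in (0 : ℝ)..x, v y) ∧
    (∀ x ∈ Set.Icc (0 : ℝ) (π / (n : ℝ)),
      v x = v 0 + ∫ y in (0 : ℝ)..x, (φ n : ℝ → ℂ) y) ∧
    u 0 = 0 ∧ u (π / (n : ℝ)) = 0

/-- `IsWaveOperator t T` says that the bounded operator `T` is `exp (-t √(-Δ))`, where `-Δ` is the
Dirichlet Laplacian: `T` acts as multiplication by `exp (-t √E)` on the eigenspace of `-Δ` for the
eigenvalue `E`.  (The spectrum being pure point, this determines `T`; the theorem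
asserts existence and uniqueness.) -/
def IsWaveOperator (t : ℝ) (T : GraphL2 →L[ℂ] GraphL2) : Prop :=
  ∀ (E : ℝ) (ψ : GraphL2), IsDirichletLaplacian ψ (-((E : ℂ) • ψ)) →
    T ψ = (Real.exp (-t * √E) : ℂ) • ψ

/-- The operator `T` is of trace class and has trace `τ`: in every Hilbert basis the diagonal
matrix elements of `T` are summable with sum `τ`. -/
def HasTrace (T : GraphL2 →L[ℂ] GraphL2) (τ : ℂ) : Prop :=
  ∀ (ι : Type) (b : HilbertBasis ι ℂ GraphL2),
    HasSum (fun i => inner ℂ (b i) (T (b i))) τ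

/-- `Θ(t) = ∑ d(n) exp (-n t)`, where `d` is the divisor function (the term `n = 0` vanishes, since
`Nat.divisors 0 = ∅`). -/
def Theta (t : ℝ) : ℝ :=
  ∑' n : ℕ, (n.divisors.card : ℝ) * Real.exp (-(n : ℝ) * t)

/-- The coefficient `B_{m+1}² / ((m+1) (m+1)!)` of `(-t)^m`. -/
def coeff (m : ℕ) : ℝ :=
  ((bernoulli (m + 1) : ℚ) : ℝ) ^ 2 / (((m : ℝ) + 1) * ((m + 1).factorial : ℝ))

/-- The expansion of `Θ(t)` truncated after the power `t^N`. -/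
def truncation (N : ℕ) (t : ℝ) : ℝ :=
  -Real.log t / t + Real.eulerMascheroniConstant / t + 1 / 4 +
    ∑ m ∈ Finset.Icc 1 N, coeff m * (-t) ^ m

/-- The Mellin density `Γ(z) ζ(z)²`. -/
def mellinDensity (z : ℂ) : ℂ := Complex.Gamma z * riemannZeta z ^ 2

/-- The error term `(2 π i)⁻¹ ∫ t^(-z) Γ(z) ζ(z)² dz`, along the upward vertical line
`Re z = κ`. -/
def remainder (κ t : ℝ) : ℂ := mellinInv κ mellinDensity t

end DirichletGraph

end

/-! Spectral side. The normalized functions sin(knx) on the edge of length π/n form a Hilbert basis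
of eigenfunctions with eigenvalues (kn)² (`graphBasis`). Hence the wave operator is diagonal with
eigenvalues exp(-knt). Tonelli's theorem makes its trace the same in every Hilbert basis
(`hasSum_inner_diagonalOperator`), and grouping the pairs (n, k) by their product, with d(N) pairs
for the product N, gives Θ (`hasSum_waveEigenvalue`).

Analytic side. Writing each exp(-nt) as a Cahen–Mellin integral over Re z = 2 and summing the
Dirichlet series of d, which is ζ², turns Θ(t) into the integral of t^(-z) Γ(z) ζ(z)² over that line
(`Theta_eq_remainder_two`). In vertical strips Γ decays faster than any power of the ordinate, while
ζ grows polynomially, so the density decays (`exists_norm_mellinDensity_le`) and the contour can be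
moved to the left. The double pole at 1 contributes the terms with ln t and γ; the poles of Γ at 0,
-1, -2, … contribute 1/4 and the Bernoulli terms (`remainder_two_eq`). On Re z = κ the integral is
O(t^(-κ)), which gives the asymptotic expansion.

Divergence. Since |B_{2k}| ≥ (2k)!/(2π)^{2k}, the square of the Bernoulli number outweighs the
single factorial below it, and the terms of the series are unbounded at every nonzero point. For t >
0 no term with m ≥ 1 is positive, because B_{m+1} = 0 for even m ≥ 2. The truncations therefore tend
to -∞ while Θ(t) stays fixed, so the remainders cannot tend to 0. -/

noncomputable section

/-! ### Residue calculus for integrals over vertical lines. -/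

namespace DirichletGraph

open Complex MeasureTheory Filter Set

/-- A continuous function on the line which decays like `y⁻²` is integrable. -/
lemma integrable_of_le_inv_sq {f : ℝ → ℂ} (hf : Continuous f) {C : ℝ}
    (hC : ∀ y : ℝ, 1 ≤ |y| → ‖f y‖ ≤ C / y ^ 2) : Integrable f := by
  obtain ⟨M, hM⟩ := isCompact_Icc.exists_bound_of_continuousOn
    (s := Icc (-1 : ℝ) 1) hf.continuousOn
  have hM0 : 0 ≤ M := (norm_nonneg _).trans (hM 0 (by simp))
  have hC0 : 0 ≤ C := by
    have := (norm_nonneg _).trans (hC 1 (by simp))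
    simpa using this
  refine (integrable_inv_one_add_sq.const_mul (2 * C + 2 * M)).mono' hf.aestronglyMeasurable
    (ae_of_all _ fun y => ?_)
  rw [← div_eq_mul_inv, le_div_iff₀ (by positivity)]
  rcases le_total 1 |y| with h | h
  · have hy : 1 ≤ y ^ 2 := by rw [← sq_abs]; nlinarith
    have := hC y h
    rw [le_div_iff₀ (by positivity)] at this
    nlinarith [norm_nonneg (f y)]
  · have hy : y ^ 2 ≤ 1 := by rw [← sq_abs]; nlinarith [abs_nonneg y]
    have := hM y (abs_le.mp h)
    nlinarith [norm_nonneg (f y)]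

/-- The integrals of a holomorphic function over two vertical lines agree when it decays in the
strip between the lines. -/
lemma verticalIntegral_eq_of_differentiableOn {F : ℂ → ℂ} {a b C : ℝ} (hab : a ≤ b)
    (hF : DifferentiableOn ℂ F {z | a ≤ z.re ∧ z.re ≤ b})
    (hC : ∀ z : ℂ, a ≤ z.re → z.re ≤ b → 1 ≤ |z.im| → ‖F z‖ ≤ C / z.im ^ 2) :
    ∫ y : ℝ, F (a + y * I) = ∫ y : ℝ, F (b + y * I) := by
  have hcont : ∀ σ : ℝ, a ≤ σ → σ ≤ b → Continuous fun y : ℝ => F (σ + y * I) := by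
    intro σ h1 h2
    refine hF.continuousOn.comp_continuous (by fun_prop) fun y => ?_
    simp [h1, h2]
  have hint : ∀ σ : ℝ, a ≤ σ → σ ≤ b → Integrable fun y : ℝ => F (σ + y * I) := by
    intro σ h1 h2
    refine integrable_of_le_inv_sq (hcont σ h1 h2) (C := C) fun y hy => ?_
    simpa using hC (σ + y * I) (by simpa) (by simpa) (by simpa)
  have hlim : ∀ σ : ℝ, a ≤ σ → σ ≤ b →
      Tendsto (fun R : ℝ => ∫ y in (-R)..R, F (σ + y * I)) atTop
        (𝓝 (∫ y : ℝ, F (σ + y * I))) := fun σ h1 h2 =>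
    intervalIntegral_tendsto_integral (hint σ h1 h2) tendsto_neg_atTop_atBot tendsto_id
  have hhor : ∀ s : ℝ, |s| = 1 →
      Tendsto (fun R : ℝ => ∫ x in a..b, F (x + (s * R : ℝ) * I)) atTop (𝓝 0) := by
    intro s hs
    have hs2 : s ^ 2 = 1 := by rw [← sq_abs, hs]; norm_num
    have h0 : Tendsto (fun R : ℝ => C / R ^ 2 * |b - a|) atTop (𝓝 0) := by
      have : Tendsto (fun R : ℝ => C / R ^ 2) atTop (𝓝 0) :=
        tendsto_const_nhds.div_atTop (tendsto_pow_atTop two_ne_zero)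
      simpa using this.mul_const (|b - a|)
    refine squeeze_zero_norm' ?_ h0
    filter_upwards [eventually_ge_atTop 1] with R hR
    refine intervalIntegral.norm_integral_le_of_norm_le_const fun x hx => ?_
    rw [uIoc_of_le hab] at hx
    have := hC (x + (s * R : ℝ) * I) (by simpa using hx.1.le) (by simpa using hx.2)
      (by simpa [abs_mul, hs] using hR.trans (le_abs_self R))
    simpa [mul_pow, hs2] using this
  have hrect : ∀ R : ℝ, (∫ x in a..b, F (x + ((-1 : ℝ) * R : ℝ) * I)) -
      (∫ x in a..b, F (x + ((1 : ℝ) * R : ℝ) * I)) +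
      I * (∫ y in (-R)..R, F (b + y * I)) - I * (∫ y in (-R)..R, F (a + y * I)) = 0 := by
    intro R
    have := integral_boundary_rect_eq_zero_of_differentiableOn F (a - R * I) (b + R * I) ?_
    · simpa using this
    · refine hF.mono fun z hz => ?_
      have := hz.1
      simp only [sub_re, ofReal_re, mul_re, I_re, mul_zero, ofReal_im, I_im, mul_one, sub_self,
        sub_zero, add_re, add_zero, mem_preimage, uIcc_of_le hab] at this
      exact this
  have h := (((hhor (-1) (by simp)).sub (hhor 1 (by simp))).add
    ((hlim b hab le_rfl).const_mul I)).sub ((hlim a le_rfl hab).const_mul I)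
  have h' := tendsto_nhds_unique (h.congr hrect) tendsto_const_nhds
  have hI : I * ((∫ y : ℝ, F (b + y * I)) - ∫ y : ℝ, F (a + y * I)) = 0 := by
    linear_combination h'
  have := (mul_eq_zero.mp hI).resolve_left I_ne_zero
  exact (sub_eq_zero.mp this).symm

lemma integral_div_sq_add_sq {σ : ℝ} (hσ : 0 < σ) :
    Integrable (fun y : ℝ => σ / (σ ^ 2 + y ^ 2)) ∧ ∫ y : ℝ, σ / (σ ^ 2 + y ^ 2) = π := by
  have h : (fun y : ℝ => σ / (σ ^ 2 + y ^ 2)) = fun y => σ⁻¹ * (1 + (σ⁻¹ * y) ^ 2)⁻¹ := by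
    ext y
    field_simp
  rw [h]
  refine ⟨(integrable_inv_one_add_sq.comp_mul_left' (inv_ne_zero hσ.ne')).const_mul _, ?_⟩
  rw [integral_const_mul,
    Measure.integral_comp_mul_left (fun y : ℝ => (1 + y ^ 2)⁻¹) σ⁻¹, integral_univ_inv_one_add_sq]
  rw [inv_inv, abs_of_pos hσ, smul_eq_mul, inv_mul_cancel_left₀ hσ.ne']

lemma integral_div_sq_add_sq_of_neg {σ : ℝ} (hσ : σ < 0) :
    Integrable (fun y : ℝ => σ / (σ ^ 2 + y ^ 2)) ∧ ∫ y : ℝ, σ / (σ ^ 2 + y ^ 2) = -π := by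
  have h := integral_div_sq_add_sq (neg_pos.mpr hσ)
  have e : (fun y : ℝ => σ / (σ ^ 2 + y ^ 2)) = fun y => -(-σ / ((-σ) ^ 2 + y ^ 2)) := by
    ext y; rw [neg_sq]; ring
  rw [e, integral_neg, h.2]
  exact ⟨h.1.neg, rfl⟩

lemma norm_ge_abs_im_add (σ y : ℝ) : |y| ≤ ‖(σ : ℂ) + y * I‖ := by
  simpa using Complex.abs_im_le_norm ((σ : ℂ) + y * I)

lemma ofReal_add_mul_I_ne_zero {σ : ℝ} (hσ : σ ≠ 0) (y : ℝ) : (σ : ℂ) + y * I ≠ 0 := fun h => by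
  have := congrArg Complex.re h
  simp at this
  exact hσ this

/-- The model kernel with a simple pole of residue one at the origin. -/
lemma integrable_kernel {L σ : ℝ} (hσ : σ ≠ 0) (hL : L + σ ≠ 0) :
    Integrable fun y : ℝ => (L : ℂ) / ((σ + y * I) * (L + (σ + y * I))) := by
  have h2 : ∀ y : ℝ, (L : ℂ) + (σ + y * I) ≠ 0 := fun y => by
    have := ofReal_add_mul_I_ne_zero hL y
    push_cast at this
    rwa [add_assoc] at this
  refine integrable_of_le_inv_sq (C := |L|) ?_ fun y hy => ?_
  · refine Continuous.div (by fun_prop) (by fun_prop) fun y => ?_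
    exact mul_ne_zero (ofReal_add_mul_I_ne_zero hσ y) (h2 y)
  · rw [norm_div, norm_mul, Complex.norm_real, Real.norm_eq_abs, ← sq_abs y, sq]
    have e : (L : ℂ) + (σ + y * I) = ((L + σ : ℝ) : ℂ) + y * I := by push_cast; ring
    have h1 := norm_ge_abs_im_add σ y
    have h3 := norm_ge_abs_im_add (L + σ) y
    rw [← e] at h3
    gcongr

/-- In the partial fractions 1/w - 1/(L+w) neither summand is integrable. Averaging over y and -y
leaves the real parts, which are integrable Poisson kernels. -/
lemma integral_kernel_eq {L σ : ℝ} (hσ : σ ≠ 0) (hL : L + σ ≠ 0) :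
    ∫ y : ℝ, (L : ℂ) / ((σ + y * I) * (L + (σ + y * I))) =
      ((∫ y : ℝ, (σ / (σ ^ 2 + y ^ 2) - (L + σ) / ((L + σ) ^ 2 + y ^ 2)) : ℝ) : ℂ) := by
  set k : ℝ → ℂ := fun y => (L : ℂ) / ((σ + y * I) * (L + (σ + y * I))) with hk
  have hint : Integrable k := integrable_kernel hσ hL
  have h1 : ∫ y, k y = (1 / 2 : ℂ) * ∫ y, (k y + k (-y)) := by
    rw [integral_add hint hint.comp_neg, integral_neg_eq_self]
    ring
  rw [h1, ← integral_const_mul, ← integral_complex_ofReal]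
  congr 1
  ext y
  have kk : ∀ y : ℝ, k y = 1 / (σ + y * I) - 1 / ((L + σ : ℝ) + y * I) := by
    intro y
    have a1 := ofReal_add_mul_I_ne_zero hσ y
    have a3 := ofReal_add_mul_I_ne_zero hL y
    simp only [hk]
    rw [show (L : ℂ) + (σ + y * I) = ((L + σ : ℝ) : ℂ) + y * I by push_cast; ring]
    field_simp
    push_cast
    ring
  have hpair : ∀ s : ℝ, s ≠ 0 →
      1 / ((s : ℂ) + y * I) + 1 / ((s : ℂ) + (-y : ℝ) * I) = 2 * (s / (s ^ 2 + y ^ 2)) := by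
    intro s hs
    have a1 := ofReal_add_mul_I_ne_zero hs y
    have a2 := ofReal_add_mul_I_ne_zero hs (-y)
    have e : (s : ℂ) ^ 2 + y ^ 2 = (s + y * I) * (s + (-y : ℝ) * I) := by
      push_cast
      linear_combination ((y : ℂ) ^ 2) * I_sq
    rw [e, div_add_div _ _ a1 a2, ← mul_div_assoc]
    congr 1
    push_cast
    ring
  rw [kk, kk]
  have p1 := hpair σ hσ
  have p2 := hpair (L + σ) hL
  push_cast at p1 p2 ⊢
  linear_combination (1 / 2 : ℂ) * p1 - (1 / 2 : ℂ) * p2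

lemma integral_kernel_of_pos {L σ : ℝ} (hL : 0 < L) (hσ : 0 < σ) :
    ∫ y : ℝ, (L : ℂ) / ((σ + y * I) * (L + (σ + y * I))) = 0 := by
  have h1 := integral_div_sq_add_sq hσ
  have h2 := integral_div_sq_add_sq (add_pos hL hσ)
  rw [integral_kernel_eq hσ.ne' (by positivity), integral_sub h1.1 h2.1, h1.2, h2.2]
  simp

/-- Left of the pole the Poisson kernel of σ has mass -π instead of π. The jump of 2π across the
pole is the source of all residues below. -/
lemma integral_kernel_of_neg {L σ : ℝ} (hL : 0 < L + σ) (hσ : σ < 0) :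
    ∫ y : ℝ, (L : ℂ) / ((σ + y * I) * (L + (σ + y * I))) = -(2 * π : ℝ) := by
  have h1 := integral_div_sq_add_sq_of_neg hσ
  have h2 := integral_div_sq_add_sq hL
  rw [integral_kernel_eq hσ.ne hL.ne', integral_sub h1.1 h2.1, h1.2, h2.2]
  push_cast
  ring

/-- The primitive I/(σ+iy) vanishes at both ends, so a pure double pole contributes nothing. -/
lemma integral_inv_sq {σ : ℝ} (hσ : σ ≠ 0) :
    Integrable (fun y : ℝ => 1 / ((σ : ℂ) + y * I) ^ 2) ∧
      ∫ y : ℝ, 1 / ((σ : ℂ) + y * I) ^ 2 = 0 := by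
  have hint : Integrable (fun y : ℝ => 1 / ((σ : ℂ) + y * I) ^ 2) := by
    refine integrable_of_le_inv_sq (C := 1) ?_ fun y hy => ?_
    · exact Continuous.div (by fun_prop) (by fun_prop) fun y =>
        pow_ne_zero _ (ofReal_add_mul_I_ne_zero hσ y)
    · rw [norm_div, norm_pow, norm_one, ← sq_abs y]
      have h1 := norm_ge_abs_im_add σ y
      gcongr
  refine ⟨hint, ?_⟩
  have hder : ∀ y : ℝ, HasDerivAt (fun y : ℝ => I / ((σ : ℂ) + y * I))
      (1 / ((σ : ℂ) + y * I) ^ 2) y := by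
    intro y
    have h0 : HasDerivAt (fun y : ℝ => (σ : ℂ) + y * I) I y := by
      simpa using ((hasDerivAt_id y).ofReal_comp.mul_const I).const_add (σ : ℂ)
    have := (hasDerivAt_const y I).fun_div h0 (ofReal_add_mul_I_ne_zero hσ y)
    rwa [I_mul_I, zero_mul, zero_sub, neg_neg] at this
  have hnorm : ∀ y : ℝ, y ≠ 0 → ‖I / ((σ : ℂ) + y * I)‖ ≤ |y|⁻¹ := by
    intro y hy
    rw [norm_div, norm_I, one_div]
    exact inv_anti₀ (abs_pos.mpr hy) (norm_ge_abs_im_add σ y)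
  have ht : Tendsto (fun y : ℝ => I / ((σ : ℂ) + y * I)) atTop (𝓝 0) :=
    squeeze_zero_norm' ((eventually_ne_atTop 0).mono hnorm)
      (tendsto_inv_atTop_zero.comp tendsto_abs_atTop_atTop)
  have hb : Tendsto (fun y : ℝ => I / ((σ : ℂ) + y * I)) atBot (𝓝 0) :=
    squeeze_zero_norm' ((eventually_ne_atBot 0).mono hnorm)
      (tendsto_inv_atTop_zero.comp tendsto_abs_atBot_atTop)
  simpa using integral_of_hasDerivAt_of_tendsto hder hint hb ht

lemma re_neighborhood {a b p : ℝ} (hap : a < p) (hpb : p < b) :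
    {z : ℂ | a ≤ z.re ∧ z.re ≤ b} ∈ 𝓝 (p : ℂ) := by
  have h : {z : ℂ | a < z.re ∧ z.re < b} ∈ 𝓝 (p : ℂ) :=
    ((isOpen_lt continuous_const continuous_re).inter
      (isOpen_lt continuous_re continuous_const)).mem_nhds (by simp [hap, hpb])
  exact mem_of_superset h fun z hz => ⟨hz.1.le, hz.2.le⟩

/-- The factor L/(L+(z-p)) equals 1 at p, so the subtracted function vanishes there and its `dslope`
at p is a plain quotient away from p. -/
lemma dslope_sub_kernel {A : ℂ → ℂ} {p L : ℝ} (hL : 0 < L) {z : ℂ} (hz : z ≠ p) :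
    dslope (fun z => A z - A p * (L / (L + (z - p)))) p z =
      (A z - A p * (L / (L + (z - p)))) / (z - p) := by
  have hL' : (L : ℂ) ≠ 0 := by exact_mod_cast hL.ne'
  rw [dslope_of_ne _ hz, slope_def_field]
  simp [div_self hL']

/-- The auxiliary function that removes a simple pole: it is holomorphic in the strip and decays
one power better. -/
lemma dslope_sub_kernel_strip {A : ℂ → ℂ} {a b p L C : ℝ} (hap : a < p) (hpb : p < b)
    (hL : p - a < L) (hA : DifferentiableOn ℂ A {z | a ≤ z.re ∧ z.re ≤ b})
    (hC : ∀ z : ℂ, a ≤ z.re → z.re ≤ b → 1 ≤ |z.im| → ‖A z‖ ≤ C / |z.im|) :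
    DifferentiableOn ℂ (dslope (fun z => A z - A p * (L / (L + (z - p)))) p)
      {z | a ≤ z.re ∧ z.re ≤ b} ∧
    ∀ z : ℂ, a ≤ z.re → z.re ≤ b → 1 ≤ |z.im| →
      ‖dslope (fun z => A z - A p * (L / (L + (z - p)))) p z‖ ≤ (C + ‖A p‖ * L) / z.im ^ 2 := by
  have hL0 : 0 < L := (sub_pos.mpr hap).trans hL
  have hne : ∀ z : ℂ, a ≤ z.re → (L : ℂ) + (z - p) ≠ 0 := fun z hz h => by
    have := congrArg Complex.re h
    simp at this
    linarith
  constructor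
  · rw [differentiableOn_dslope (re_neighborhood hap hpb)]
    refine hA.sub (DifferentiableOn.const_mul (DifferentiableOn.div (by fun_prop) (by fun_prop)
      fun z hz => hne z hz.1) _)
  · intro z h1 h2 h3
    have hy : 0 < |z.im| := zero_lt_one.trans_le h3
    have hzp : z ≠ p := fun h => by
      rw [h] at hy
      simp at hy
    rw [dslope_sub_kernel hL0 hzp, norm_div, ← sq_abs z.im, sq, ← div_div]
    have e1 : |z.im| ≤ ‖z - p‖ := by simpa using Complex.abs_im_le_norm (z - p)
    have e2 : |z.im| ≤ ‖(L : ℂ) + (z - p)‖ := by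
      simpa using Complex.abs_im_le_norm ((L : ℂ) + (z - p))
    have e3 : ‖A z - A p * (L / (L + (z - p)))‖ ≤ (C + ‖A p‖ * L) / |z.im| := by
      refine (norm_sub_le _ _).trans ?_
      rw [add_div]
      refine add_le_add (hC z h1 h2 h3) ?_
      rw [norm_mul, norm_div, Complex.norm_real, Real.norm_eq_abs, abs_of_pos hL0, mul_div_assoc]
      gcongr
    exact div_le_div₀ ((norm_nonneg _).trans e3) e3 hy e1

/-- The residue theorem for the strip between two vertical lines, for a simple pole. -/
lemma verticalIntegral_sub_eq_residue {A : ℂ → ℂ} {a b p C : ℝ} (hap : a < p) (hpb : p < b)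
    (hA : DifferentiableOn ℂ A {z | a ≤ z.re ∧ z.re ≤ b})
    (hC : ∀ z : ℂ, a ≤ z.re → z.re ≤ b → 1 ≤ |z.im| → ‖A z‖ ≤ C / |z.im|) :
    (∫ y : ℝ, A (b + y * I) / (b + y * I - p)) - ∫ y : ℝ, A (a + y * I) / (a + y * I - p) =
      2 * π * A p := by
  -- Any L > p - a serves: the second pole p - L of the model kernel then lies to the left of the
  -- strip.
  set L : ℝ := p - a + 1
  have hL : p - a < L := by simp [L]
  have hL0 : 0 < L := by simp only [L]; linarith
  obtain ⟨hD, hDC⟩ := dslope_sub_kernel_strip hap hpb hL hA hC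
  set D := dslope (fun z => A z - A p * (L / (L + (z - p)))) p with hDdef
  have key : ∀ σ : ℝ, a ≤ σ → σ ≤ b → σ ≠ p →
      ∫ y : ℝ, A (σ + y * I) / (σ + y * I - p) = (∫ y : ℝ, D (σ + y * I)) +
        A p * ∫ y : ℝ, (L : ℂ) / (((σ - p : ℝ) + y * I) * (L + ((σ - p : ℝ) + y * I))) := by
    intro σ h1 h2 h3
    have hσ : σ - p ≠ 0 := sub_ne_zero.mpr h3
    have hLσ : L + (σ - p) ≠ 0 := by
      have : 0 < L + (σ - p) := by linarith
      exact this.ne'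
    rw [← integral_const_mul, ← integral_add]
    · congr 1
      ext y
      have hz : ((σ : ℂ) + y * I) ≠ p := fun h => by
        have := congrArg Complex.re h
        simp at this
        exact h3 this
      rw [hDdef, dslope_sub_kernel hL0 hz]
      have q1 := sub_ne_zero.mpr hz
      have q2 : (L : ℂ) + (σ + y * I - p) ≠ 0 := fun h => by
        have := congrArg Complex.re h
        simp at this
        exact hLσ this
      rw [show (((σ - p : ℝ) : ℂ) + y * I) = σ + y * I - p by push_cast; ring]
      field_simp
      ring
    · refine integrable_of_le_inv_sq (C := C + ‖A p‖ * L) ?_ fun y hy => ?_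
      · exact hD.continuousOn.comp_continuous (by fun_prop) fun y => by simp [h1, h2]
      · simpa using hDC (σ + y * I) (by simpa) (by simpa) (by simpa)
    · exact (integrable_kernel hσ hLσ).const_mul _
  rw [key b (hap.trans hpb).le le_rfl hpb.ne', key a le_rfl (hap.trans hpb).le hap.ne,
    verticalIntegral_eq_of_differentiableOn (hap.trans hpb).le hD hDC,
    integral_kernel_of_pos hL0 (sub_pos.mpr hpb),
    integral_kernel_of_neg (by linarith) (sub_neg.mpr hap)]
  push_cast
  ring

/-- The residue theorem for the strip between two vertical lines, for a double pole. -/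
lemma verticalIntegral_sub_eq_residue_double {A : ℂ → ℂ} {a b p C : ℝ} (hap : a < p) (hpb : p < b)
    (hA : DifferentiableOn ℂ A {z | a ≤ z.re ∧ z.re ≤ b})
    (hC : ∀ z : ℂ, a ≤ z.re → z.re ≤ b → 1 ≤ |z.im| → ‖A z‖ ≤ C / |z.im|) :
    (∫ y : ℝ, A (b + y * I) / (b + y * I - p) ^ 2) -
        ∫ y : ℝ, A (a + y * I) / (a + y * I - p) ^ 2 = 2 * π * deriv A p := by
  set L : ℝ := p - a + 1
  have hL : p - a < L := by simp [L]
  have hL0 : 0 < L := by simp only [L]; linarith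
  have hL' : (L : ℂ) ≠ 0 := by exact_mod_cast hL0.ne'
  obtain ⟨hD, hDC⟩ := dslope_sub_kernel_strip hap hpb hL hA hC
  set D := dslope (fun z => A z - A p * (L / (L + (z - p)))) p with hDdef
  -- The derivative of L/(L+(z-p)) at p is -1/L. The resulting extra term is cancelled by the jump
  -- of the model kernel in `key`.
  have hDp : D p = deriv A p + A p / L := by
    rw [hDdef, dslope_same]
    have h1 : HasDerivAt A (deriv A p) p :=
      (hA.differentiableAt (re_neighborhood hap hpb)).hasDerivAt
    have h2 : HasDerivAt (fun z : ℂ => (L : ℂ) + (z - p)) 1 p := by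
      simpa using ((hasDerivAt_id (p : ℂ)).sub_const (p : ℂ)).const_add (L : ℂ)
    have h3 := (hasDerivAt_const (p : ℂ) (L : ℂ)).fun_div h2 (by simpa using hL')
    have h4 := (h1.sub (h3.const_mul (A p))).deriv
    rw [show (fun z => A z - A p * (L / (L + (z - p)))) =
      (A - fun z => A p * (L / (L + (z - p)))) from rfl, h4]
    simp only [sub_self, add_zero]
    field_simp
    ring
  have hres := verticalIntegral_sub_eq_residue (C := C + ‖A p‖ * L) hap hpb hD fun z h1 h2 h3 => by
    refine (hDC z h1 h2 h3).trans ?_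
    have hy : 0 < |z.im| := zero_lt_one.trans_le h3
    have h0 : 0 ≤ C + ‖A p‖ * L := by
      have h4 := (norm_nonneg _).trans (hC z h1 h2 h3)
      have : 0 ≤ C := by
        have := mul_nonneg h4 hy.le
        rwa [div_mul_cancel₀ _ hy.ne'] at this
      positivity
    rw [← sq_abs]
    gcongr
    nlinarith
  -- With w = z - p, L/((L+w)w²) = 1/w² - 1/(w(L+w)): the double pole splits into a simple pole with
  -- numerator D, the model kernel, and 1/w², whose integral is zero.
  have key : ∀ σ : ℝ, a ≤ σ → σ ≤ b → σ ≠ p →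
      ∫ y : ℝ, A (σ + y * I) / (σ + y * I - p) ^ 2 =
        (∫ y : ℝ, D (σ + y * I) / (σ + y * I - p)) -
        A p / L * ∫ y : ℝ, (L : ℂ) / (((σ - p : ℝ) + y * I) * (L + ((σ - p : ℝ) + y * I))) := by
    intro σ h1 h2 h3
    have hσ : σ - p ≠ 0 := sub_ne_zero.mpr h3
    have hLσ : L + (σ - p) ≠ 0 := by
      have : 0 < L + (σ - p) := by linarith
      exact this.ne'
    have hsq := integral_inv_sq hσ
    have hz : ∀ y : ℝ, (σ : ℂ) + y * I ≠ p := fun y h => by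
      have := congrArg Complex.re h
      simp at this
      exact h3 this
    have hDint : Integrable fun y : ℝ => D (σ + y * I) / (σ + y * I - p) := by
      refine integrable_of_le_inv_sq (C := C + ‖A p‖ * L) ?_ fun y hy => ?_
      · refine Continuous.div ?_ (by fun_prop) fun y => sub_ne_zero.mpr (hz y)
        exact hD.continuousOn.comp_continuous (by fun_prop) fun y => by simp [h1, h2]
      · have q := hDC (σ + y * I) (by simpa) (by simpa) (by simpa)
        have e1 : |y| ≤ ‖(σ : ℂ) + y * I - p‖ := by
          simpa using Complex.abs_im_le_norm ((σ : ℂ) + y * I - p)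
        rw [norm_div]
        refine (div_le_self (norm_nonneg _) (hy.trans e1)).trans ?_
        simpa using q
    have hker := (integrable_kernel hσ hLσ).const_mul (A p / L)
    have : ∫ y : ℝ, A (σ + y * I) / (σ + y * I - p) ^ 2 =
        ∫ y : ℝ, (D (σ + y * I) / (σ + y * I - p) -
          A p / L * ((L : ℂ) / (((σ - p : ℝ) + y * I) * (L + ((σ - p : ℝ) + y * I)))) +
          A p * (1 / (((σ - p : ℝ) : ℂ) + y * I) ^ 2)) := by
      congr 1
      ext y
      rw [hDdef, dslope_sub_kernel hL0 (hz y)]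
      have q1 := sub_ne_zero.mpr (hz y)
      have q2 : (L : ℂ) + (σ + y * I - p) ≠ 0 := fun h => by
        have := congrArg Complex.re h
        simp at this
        exact hLσ this
      rw [show (((σ - p : ℝ) : ℂ) + y * I) = σ + y * I - p by push_cast; ring]
      generalize (σ : ℂ) + y * I - p = w at *
      field_simp
      ring
    have hs : Integrable fun y : ℝ => D (σ + y * I) / (σ + y * I - p) -
        A p / L * ((L : ℂ) / (((σ - p : ℝ) + y * I) * (L + ((σ - p : ℝ) + y * I)))) :=
      hDint.sub hker
    rw [this, integral_add hs (hsq.1.const_mul _), integral_sub hDint hker,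
      integral_const_mul, integral_const_mul, hsq.2, mul_zero, add_zero]
  rw [key b (hap.trans hpb).le le_rfl hpb.ne', key a le_rfl (hap.trans hpb).le hap.ne,
    integral_kernel_of_pos hL0 (sub_pos.mpr hpb),
    integral_kernel_of_neg (by linarith) (sub_neg.mpr hap)]
  rw [hDp] at hres
  push_cast
  linear_combination hres

end DirichletGraph

/-! ### Bounds for Γ, ζ and the Mellin density in vertical strips. -/

namespace DirichletGraph

open Complex MeasureTheory Filter Set

lemma norm_Gamma_le_of_re_pos {z : ℂ} (hz : 0 < z.re) : ‖Gamma z‖ ≤ Real.Gamma z.re := by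
  rw [Gamma_eq_integral hz, Real.Gamma_eq_integral hz, GammaIntegral]
  refine (norm_integral_le_integral_norm _).trans_eq ?_
  refine setIntegral_congr_fun measurableSet_Ioi fun x hx => ?_
  simp only [norm_mul, Complex.norm_real, Real.norm_eq_abs, abs_of_pos (Real.exp_pos _),
    norm_cpow_eq_rpow_re_of_pos hx, sub_re, one_re]

/-- Rapid decay of the Gamma function along vertical lines. -/
lemma norm_Gamma_mul_im_pow_le (k : ℕ) {z : ℂ} (hz : 0 < z.re + k) (hy : z.im ≠ 0) :
    ‖Gamma z‖ * |z.im| ^ k ≤ Real.Gamma (z.re + k) := by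
  induction k generalizing z with
  | zero => simpa using norm_Gamma_le_of_re_pos (by simpa using hz)
  | succ k ih =>
    have h0 : z ≠ 0 := fun h => hy (by simp [h])
    -- Each use of Γ(z+1) = zΓ(z) gains one factor |z| ≥ |Im z|.
    have h1 := ih (z := z + 1) (by push_cast at hz; simp only [add_re, one_re]; linarith)
      (by simpa using hy)
    rw [Gamma_add_one z h0, norm_mul] at h1
    simp only [add_im, one_im, add_zero, add_re, one_re] at h1
    push_cast
    rw [show z.re + (k + 1) = z.re + 1 + k by ring]
    refine le_trans ?_ h1
    rw [pow_succ]
    have := abs_im_le_norm z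
    nlinarith [mul_le_mul_of_nonneg_left this
      (show 0 ≤ ‖Gamma z‖ * |z.im| ^ k by positivity)]

lemma exists_norm_Gamma_le (a b : ℝ) (k : ℕ) :
    ∃ C, 0 ≤ C ∧ ∀ z : ℂ, a ≤ z.re → z.re ≤ b → 1 ≤ |z.im| → ‖Gamma z‖ ≤ C / |z.im| ^ k := by
  -- A shift by m makes the real parts positive and k more steps give the decay. The surplus powers
  -- of |Im z| ≥ 1 are dropped at the end.
  obtain ⟨m, hm⟩ := exists_nat_gt (-a)
  set n := m + k
  have hpos : ∀ x ∈ Icc a b, 0 < x + n := fun x hx => by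
    have : (0 : ℝ) ≤ k := k.cast_nonneg
    simp only [n, Nat.cast_add]
    linarith [hx.1]
  have hcont : ContinuousOn (fun x : ℝ => Real.Gamma (x + n)) (Icc a b) := by
    intro x hx
    have h1 : ContinuousAt Real.Gamma (x + n) :=
      (Real.differentiableAt_Gamma fun j => by
        have := hpos x hx
        have hj : (0 : ℝ) ≤ j := j.cast_nonneg
        linarith).continuousAt
    exact (ContinuousAt.comp (f := fun x : ℝ => x + n) h1 (by fun_prop)).continuousWithinAt
  obtain ⟨C, hC⟩ := isCompact_Icc.exists_bound_of_continuousOn hcont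
  refine ⟨max C 0, le_max_right _ _, fun z h1 h2 h3 => ?_⟩
  have hy : 0 < |z.im| := zero_lt_one.trans_le h3
  rw [le_div_iff₀ (by positivity)]
  have := norm_Gamma_mul_im_pow_le n (hpos z.re ⟨h1, h2⟩) (abs_pos.mp hy)
  have hb := (le_abs_self _).trans (hC z.re ⟨h1, h2⟩)
  refine le_trans ?_ (this.trans (hb.trans (le_max_left _ _)))
  exact mul_le_mul_of_nonneg_left (pow_le_pow_right₀ h3 (by simp [n])) (norm_nonneg _)

/-- The error of the trapezoidal rule for `x ↦ x ^ (-s)` on `[n, n + 1]`, multiplied by `s - 1`. -/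
def trapezoidError (n : ℕ) (s : ℂ) : ℂ :=
  (s - 1) * (((n + 1 : ℕ) : ℂ) ^ (-s) + ((n + 2 : ℕ) : ℂ) ^ (-s)) / 2 +
    (((n + 2 : ℕ) : ℂ) ^ (1 - s) - ((n + 1 : ℕ) : ℂ) ^ (1 - s))

lemma differentiable_trapezoidError (n : ℕ) : Differentiable ℂ (trapezoidError n) := by
  have h1 : ((n + 1 : ℕ) : ℂ) ≠ 0 := by exact_mod_cast n.succ_ne_zero
  have h2 : ((n + 2 : ℕ) : ℂ) ≠ 0 := by exact_mod_cast (n + 1).succ_ne_zero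
  unfold trapezoidError
  intro s
  have e1 : DifferentiableAt ℂ (fun s : ℂ => ((n + 1 : ℕ) : ℂ) ^ (-s)) s :=
    (differentiableAt_id.neg).const_cpow (Or.inl h1)
  have e2 : DifferentiableAt ℂ (fun s : ℂ => ((n + 2 : ℕ) : ℂ) ^ (-s)) s :=
    (differentiableAt_id.neg).const_cpow (Or.inl h2)
  have e3 : DifferentiableAt ℂ (fun s : ℂ => ((n + 1 : ℕ) : ℂ) ^ (1 - s)) s :=
    (differentiableAt_id.const_sub 1).const_cpow (Or.inl h1)
  have e4 : DifferentiableAt ℂ (fun s : ℂ => ((n + 2 : ℕ) : ℂ) ^ (1 - s)) s :=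
    (differentiableAt_id.const_sub 1).const_cpow (Or.inl h2)
  fun_prop

/-- The trapezoidal rule is exact to first order, so the error involves a second derivative and
gains two powers of n. The error series then converges for Re s > -1, beyond the critical strip. -/
lemma norm_trapezoidError_le (n : ℕ) {s : ℂ} (hs : -2 ≤ s.re) :
    ‖trapezoidError n s‖ ≤ ‖s - 1‖ * ‖s‖ * ‖s + 1‖ * ((n + 1 : ℕ) : ℝ) ^ (-(s.re + 2)) := by
  set m : ℝ := ((n + 1 : ℕ) : ℝ) with hm
  have hm0 : 0 < m := by simp only [hm]; positivity
  have hpos : ∀ u ∈ Icc (0 : ℝ) 1, 0 < m + u := fun u hu => add_pos_of_pos_of_nonneg hm0 hu.1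
  have hcpow : ∀ (c : ℂ) (u : ℝ), u ∈ Icc (0 : ℝ) 1 →
      HasDerivAt (fun u : ℝ => ((m : ℂ) + u) ^ c) (c * ((m : ℂ) + u) ^ (c - 1)) u := by
    intro c u hu
    have h0 : HasDerivAt (fun u : ℝ => (m : ℂ) + u) 1 u := by
      simpa using ((hasDerivAt_id u).ofReal_comp).const_add (m : ℂ)
    have hsl : (m : ℂ) + u ∈ slitPlane := by
      rw [← ofReal_add]
      exact ofReal_mem_slitPlane.mpr (hpos u hu)
    have h1 : HasDerivAt (fun w : ℂ => w ^ c) (c * ((m : ℂ) + u) ^ (c - 1) * 1) ((m : ℂ) + u) :=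
      (hasDerivAt_id ((m : ℂ) + u)).cpow_const hsl
    have h2 := h1.comp u h0
    rw [mul_one, mul_one] at h2
    exact h2
  -- With f(u) = (m+u)^(-s), P is a primitive of (s-1)u(1-u)f''(u), the Peano kernel form of the
  -- error, and P 1 - P 0 is twice `trapezoidError n s`.
  set P : ℝ → ℂ := fun u =>
    (s - 1) * (u * (1 - u) * (-s * ((m : ℂ) + u) ^ (-s - 1)) - (1 - 2 * u) * ((m : ℂ) + u) ^ (-s)) +
      2 * ((m : ℂ) + u) ^ (1 - s) with hP
  have hder : ∀ u ∈ Icc (0 : ℝ) 1, HasDerivAt P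
      ((s - 1) * (u * (1 - u) * (-s * ((-s - 1) * ((m : ℂ) + u) ^ (-s - 1 - 1))))) u := by
    intro u hu
    have hu0 : HasDerivAt (fun u : ℝ => (u : ℂ)) 1 u := (hasDerivAt_id u).ofReal_comp
    have d1 := (hu0.mul ((hu0.const_sub 1))).mul ((hcpow (-s - 1) u hu).const_mul (-s))
    have d2 := ((hu0.const_mul (2 : ℂ)).const_sub 1).mul (hcpow (-s) u hu)
    have d3 := ((d1.sub d2).const_mul (s - 1)).add ((hcpow (1 - s) u hu).const_mul 2)
    have : (1 - s - 1 : ℂ) = -s := by ring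
    rw [this] at d3
    refine d3.congr_deriv ?_
    simp only [Pi.mul_apply]
    ring
  have hbound : ∀ u ∈ Ico (0 : ℝ) 1,
      ‖(s - 1) * (u * (1 - u) * (-s * ((-s - 1) * ((m : ℂ) + u) ^ (-s - 1 - 1))))‖ ≤
        ‖s - 1‖ * ‖s‖ * ‖s + 1‖ * m ^ (-(s.re + 2)) := by
    intro u hu
    have hu' : u ∈ Icc (0 : ℝ) 1 := ⟨hu.1, hu.2.le⟩
    have e1 : ‖((m : ℂ) + u) ^ (-s - 1 - 1)‖ ≤ m ^ (-(s.re + 2)) := by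
      rw [← ofReal_add, norm_cpow_eq_rpow_re_of_pos (hpos u hu')]
      have : (-s - 1 - 1).re = -(s.re + 2) := by simp; ring
      rw [this]
      exact Real.rpow_le_rpow_of_nonpos hm0 (by linarith [hu.1]) (by linarith)
    have e2 : ‖(u : ℂ) * (1 - u)‖ ≤ 1 := by
      rw [← ofReal_one, ← ofReal_sub, ← ofReal_mul, Complex.norm_real, Real.norm_eq_abs, abs_le]
      constructor <;> nlinarith [hu.1, hu.2]
    have e3 : ‖-s - 1‖ = ‖s + 1‖ := by rw [← norm_neg]; congr 1; ring
    rw [norm_mul, norm_mul ((u : ℂ) * (1 - u)), norm_mul (-s), norm_mul (-s - 1), norm_neg, e3]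
    calc ‖s - 1‖ * (‖(u : ℂ) * (1 - u)‖ * (‖s‖ * (‖s + 1‖ * ‖((m : ℂ) + u) ^ (-s - 1 - 1)‖)))
        ≤ ‖s - 1‖ * (1 * (‖s‖ * (‖s + 1‖ * m ^ (-(s.re + 2))))) := by gcongr
      _ = _ := by ring
  have hmvt := norm_image_sub_le_of_norm_deriv_le_segment_01'
    (fun u hu => (hder u hu).hasDerivWithinAt) hbound
  have hval : trapezoidError n s = (1 / 2 : ℂ) * (P 1 - P 0) := by
    simp only [hP, trapezoidError, hm]
    push_cast
    rw [show (n : ℂ) + 1 + 1 = n + 2 by ring]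
    simp only [add_zero]
    ring
  rw [hval, norm_mul]
  have : ‖(1 / 2 : ℂ)‖ ≤ 1 := by norm_num
  exact (mul_le_of_le_one_left (norm_nonneg _) this).trans hmvt

lemma summable_trapezoid_bound {σ : ℝ} (hσ : -1 < σ) :
    Summable fun n : ℕ => ((n + 1 : ℕ) : ℝ) ^ (-(σ + 2)) :=
  (summable_nat_add_iff 1).mpr (Real.summable_nat_rpow.mpr (by linarith))

/-- The endpoint values sum to ζ(s) and ζ(s) - 1, and the integral terms telescope to -1. -/
lemma tsum_trapezoidError_of_one_lt {s : ℂ} (hs : 1 < s.re) :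
    HasSum (fun n => trapezoidError n s) (riemannZeta₁ s - (s - 1) / 2 - 1) := by
  have hs1 : s ≠ 1 := fun h => by simp [h] at hs
  have h1 : HasSum (fun n : ℕ => ((n + 1 : ℕ) : ℂ) ^ (-s)) (riemannZeta s) := by
    have hsum : Summable fun n : ℕ => 1 / ((n : ℂ) + 1) ^ s := by
      have := (summable_nat_add_iff 1).mpr (Complex.summable_one_div_nat_cpow.mpr hs)
      simpa using this
    have := hsum.hasSum
    rw [← zeta_eq_tsum_one_div_nat_add_one_cpow hs] at this
    convert this using 2 with n
    rw [cpow_neg, one_div]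
    push_cast
    rfl
  have h2 : HasSum (fun n : ℕ => ((n + 2 : ℕ) : ℂ) ^ (-s)) (riemannZeta s - 1) := by
    have := (hasSum_nat_add_iff' 1).mpr h1
    simpa [add_assoc, one_add_one_eq_two] using this
  have h3 : Tendsto (fun N : ℕ => ∑ n ∈ Finset.range N,
      (((n + 2 : ℕ) : ℂ) ^ (1 - s) - ((n + 1 : ℕ) : ℂ) ^ (1 - s))) atTop (𝓝 (0 - 1)) := by
    have e : (fun N : ℕ => ∑ n ∈ Finset.range N,
        (((n + 2 : ℕ) : ℂ) ^ (1 - s) - ((n + 1 : ℕ) : ℂ) ^ (1 - s))) =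
        fun N : ℕ => ((N + 1 : ℕ) : ℂ) ^ (1 - s) - 1 := by
      ext N
      rw [Finset.sum_range_sub (fun n : ℕ => ((n + 1 : ℕ) : ℂ) ^ (1 - s)) N]
      simp
    rw [e]
    refine Tendsto.sub_const ?_ 1
    rw [tendsto_zero_iff_norm_tendsto_zero]
    have e2 : (fun N : ℕ => ‖((N + 1 : ℕ) : ℂ) ^ (1 - s)‖) =
        fun N : ℕ => ((N + 1 : ℕ) : ℝ) ^ (-(s.re - 1)) := by
      ext N
      rw [norm_natCast_cpow_of_pos N.succ_pos]
      simp
    rw [e2]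
    exact (tendsto_rpow_neg_atTop (by linarith)).comp
      (tendsto_natCast_atTop_atTop.comp (tendsto_add_atTop_nat 1))
  have hsum : Summable fun n => trapezoidError n s :=
    Summable.of_norm_bounded ((summable_trapezoid_bound (by linarith)).mul_left
      (‖s - 1‖ * ‖s‖ * ‖s + 1‖)) fun n => norm_trapezoidError_le n (by linarith)
  rw [hsum.hasSum_iff_tendsto_nat]
  have h4 := ((h1.add h2).mul_left ((s - 1) / 2)).tendsto_sum_nat.add h3
  have hval : (s - 1) / 2 * (riemannZeta s + (riemannZeta s - 1)) + (0 - 1) =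
      riemannZeta₁ s - (s - 1) / 2 - 1 := by
    rw [riemannZeta_eq_inv_sub_mul hs1]
    have := sub_ne_zero.mpr hs1
    field_simp
    ring
  rw [hval] at h4
  refine h4.congr fun N => ?_
  rw [← Finset.sum_add_distrib]
  refine Finset.sum_congr rfl fun n _ => ?_
  simp only [trapezoidError]
  ring

/-- Identity theorem: both sides are holomorphic for Re s > -3/4 and agree near 2. -/
lemma tsum_trapezoidError {s : ℂ} (hs : -(3 / 4) < s.re) :
    ∑' n, trapezoidError n s = riemannZeta₁ s - (s - 1) / 2 - 1 := by
  -- Intersecting with a ball that contains s and 2 bounds the polynomial factor of the error, as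
  -- uniform convergence requires.
  set R : ℝ := ‖s‖ + 3
  set U : Set ℂ := {z | -(3 / 4) < z.re} ∩ Metric.ball 0 R
  have hUo : IsOpen U := (isOpen_lt continuous_const continuous_re).inter Metric.isOpen_ball
  have hUc : IsPreconnected U :=
    ((convex_halfSpace_re_gt _).inter (convex_ball _ _)).isPreconnected
  have hsU : s ∈ U := ⟨hs, by simp [R]⟩
  have h2U : (2 : ℂ) ∈ U := ⟨by simp; norm_num, by simp [R]; linarith [norm_nonneg s]⟩
  have hd : DifferentiableOn ℂ (fun z => ∑' n, trapezoidError n z) U := by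
    refine differentiableOn_tsum_of_summable_norm
      (u := fun n : ℕ => (R + 1) * R * (R + 1) * ((n + 1 : ℕ) : ℝ) ^ (-(-(3 / 4 : ℝ) + 2)))
      ((summable_trapezoid_bound (by norm_num)).mul_left _)
      (fun n => (differentiable_trapezoidError n).differentiableOn) hUo fun n z hz => ?_
    have hzR : ‖z‖ ≤ R := by simpa using (mem_ball_zero_iff.mp hz.2).le
    have hz0 : -(3 / 4) < z.re := hz.1
    refine (norm_trapezoidError_le n (by linarith)).trans ?_
    have k1 : ‖z - 1‖ ≤ R + 1 := (norm_sub_le _ _).trans (by simpa using hzR)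
    have k2 : ‖z + 1‖ ≤ R + 1 := (norm_add_le _ _).trans (by simpa using hzR)
    have k3 : (1 : ℝ) ≤ ((n + 1 : ℕ) : ℝ) := by simp
    gcongr
  have hd2 : DifferentiableOn ℂ (fun z => riemannZeta₁ z - (z - 1) / 2 - 1) U := by
    have : Differentiable ℂ (fun z => riemannZeta₁ z - (z - 1) / 2 - 1) := by fun_prop
    exact this.differentiableOn
  refine (hd.analyticOnNhd hUo).eqOn_of_preconnected_of_eventuallyEq (hd2.analyticOnNhd hUo)
    hUc h2U ?_ hsU
  have : {z : ℂ | 1 < z.re} ∈ 𝓝 (2 : ℂ) :=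
    (isOpen_lt continuous_const continuous_re).mem_nhds (by simp)
  filter_upwards [this] with z hz
  exact (tsum_trapezoidError_of_one_lt hz).tsum_eq

lemma norm_le_mul_abs_im {z : ℂ} {M : ℝ} (hM : |z.re| ≤ M) (hy : 1 ≤ |z.im|) :
    ‖z‖ ≤ (M + 1) * |z.im| := by
  have := Complex.norm_le_abs_re_add_abs_im z
  nlinarith [abs_nonneg z.re]

/-- Polynomial growth of `ζ` in vertical strips to the right of `-1/2`. -/
lemma exists_norm_riemannZeta_le (b : ℝ) :
    ∃ C, 0 ≤ C ∧ ∀ z : ℂ, -(1 / 2) ≤ z.re → z.re ≤ b → 1 ≤ |z.im| →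
      ‖riemannZeta z‖ ≤ C * |z.im| ^ 2 := by
  set S : ℝ := ∑' n : ℕ, ((n + 1 : ℕ) : ℝ) ^ (-(-(1 / 2 : ℝ) + 2)) with hS
  have hS0 : 0 ≤ S := tsum_nonneg fun n => by positivity
  set M : ℝ := |b| + 2
  refine ⟨2 + (M + 1) * (M + 1) * S, by positivity, fun z h1 h2 h3 => ?_⟩
  have hy : 0 < |z.im| := zero_lt_one.trans_le h3
  have hz1 : z ≠ 1 := fun h => by simp [h] at hy
  have hzs := sub_ne_zero.mpr hz1
  have ht : ‖∑' n, trapezoidError n z‖ ≤ ‖z - 1‖ * ‖z‖ * ‖z + 1‖ * S := by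
    rw [hS, ← tsum_mul_left]
    refine tsum_of_norm_bounded ((summable_trapezoid_bound (by norm_num)).mul_left _).hasSum
      fun n => (norm_trapezoidError_le n (by linarith)).trans ?_
    have k3 : (1 : ℝ) ≤ ((n + 1 : ℕ) : ℝ) := by simp
    gcongr
  rw [tsum_trapezoidError (by linarith)] at ht
  have hζ : riemannZeta z = (riemannZeta₁ z - (z - 1) / 2 - 1) / (z - 1) + 1 / 2 + 1 / (z - 1) := by
    rw [riemannZeta_eq_inv_sub_mul hz1]
    field_simp
    ring
  have hn1 : 1 ≤ ‖z - 1‖ := h3.trans (by simpa using Complex.abs_im_le_norm (z - 1))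
  -- Dividing by z - 1 removes one of the three linear factors, which leaves quadratic growth.
  have e1 : ‖(riemannZeta₁ z - (z - 1) / 2 - 1) / (z - 1)‖ ≤ ‖z‖ * ‖z + 1‖ * S := by
    rw [norm_div, div_le_iff₀ (by linarith)]
    linarith
  have e2 : ‖1 / (z - 1)‖ ≤ 1 := by
    rw [norm_div, norm_one]
    exact div_le_one_of_le₀ hn1 (by positivity)
  have hre : |z.re| ≤ |b| + 1 := abs_le.mpr ⟨by linarith [abs_nonneg b], by linarith [le_abs_self b]⟩
  have e3 : ‖z‖ ≤ (M + 1) * |z.im| := norm_le_mul_abs_im (by simp only [M]; linarith) h3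
  have e4 : ‖z + 1‖ ≤ (M + 1) * |z.im| := by
    have := norm_le_mul_abs_im (z := z + 1) (M := M) (by
      simp only [add_re, one_re, M]
      refine (abs_add_le _ _).trans ?_
      simp
      linarith) (by simpa using h3)
    simpa using this
  have hy2 : 1 ≤ |z.im| ^ 2 := one_le_pow₀ h3
  calc ‖riemannZeta z‖ ≤ ‖z‖ * ‖z + 1‖ * S + 1 + 1 := by
        rw [hζ]
        refine (norm_add₃_le).trans ?_
        have : ‖(1 / 2 : ℂ)‖ ≤ 1 := by norm_num
        linarith
    _ ≤ ((M + 1) * |z.im|) * ((M + 1) * |z.im|) * S + 1 + 1 := by gcongr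
    _ ≤ _ := by nlinarith

/-- Boundedness of `ζ` to the right of `5/4`. -/
lemma exists_norm_riemannZeta_le_of_re :
    ∃ C, 0 ≤ C ∧ ∀ z : ℂ, 5 / 4 ≤ z.re → ‖riemannZeta z‖ ≤ C := by
  have hs : Summable fun n : ℕ => 1 / ((n : ℝ) + 1) ^ (5 / 4 : ℝ) := by
    have := (summable_nat_add_iff 1).mpr
      (Real.summable_one_div_nat_rpow.mpr (show (1 : ℝ) < 5 / 4 by norm_num))
    simpa using this
  refine ⟨∑' n : ℕ, 1 / ((n : ℝ) + 1) ^ (5 / 4 : ℝ), tsum_nonneg fun n => by positivity,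
    fun z hz => ?_⟩
  rw [zeta_eq_tsum_one_div_nat_add_one_cpow (by linarith)]
  refine tsum_of_norm_bounded hs.hasSum fun n => ?_
  have e : (n : ℂ) + 1 = ((n + 1 : ℕ) : ℂ) := by push_cast; rfl
  rw [norm_div, norm_one, e, norm_natCast_cpow_of_pos n.succ_pos]
  push_cast
  have : (1 : ℝ) ≤ (n : ℝ) + 1 := by simp
  gcongr

/-- Away from the real axis one exponential dominates in both functions. The threshold 3/2 suits w =
πs/2 with |Im s| ≥ 1. -/
lemma norm_cos_le_two_mul_norm_sin {w : ℂ} (hw : 3 / 2 ≤ |w.im|) :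
    ‖Complex.cos w‖ ≤ 2 * ‖Complex.sin w‖ := by
  set E := Real.exp |w.im|
  have hE : 3 / 2 + 1 ≤ E := (by linarith : (3 / 2 + 1 : ℝ) ≤ |w.im| + 1).trans (Real.add_one_le_exp _)
  have hE' : Real.exp (-|w.im|) = E⁻¹ := Real.exp_neg _
  have hEi : E⁻¹ ≤ (3 / 2 + 1)⁻¹ := inv_anti₀ (by norm_num) hE
  have n1 : ‖cexp (w * I)‖ = Real.exp (-w.im) := by rw [norm_exp]; simp
  have n2 : ‖cexp (-w * I)‖ = Real.exp w.im := by rw [norm_exp]; simp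
  have hc : ‖Complex.cos w‖ ≤ (E + E⁻¹) / 2 := by
    rw [Complex.cos, norm_div]
    have := norm_add_le (cexp (w * I)) (cexp (-w * I))
    rw [n1, n2] at this
    rcases abs_cases w.im with h | h <;> simp only [E, h.1] at * <;> norm_num at * <;>
      linarith
  have hs : (E - E⁻¹) / 2 ≤ ‖Complex.sin w‖ := by
    rw [Complex.sin, norm_div, norm_mul, norm_I, mul_one]
    have h1 := norm_sub_norm_le (cexp (w * I)) (cexp (-w * I))
    have h2 := norm_sub_norm_le (cexp (-w * I)) (cexp (w * I))
    rw [norm_sub_rev] at h2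
    rw [n1, n2] at h1 h2
    rw [norm_sub_rev] at h1 h2
    rcases abs_cases w.im with h | h <;> simp only [E, h.1] at * <;> norm_num at * <;>
      linarith
  norm_num at hEi hE
  linarith

/-- The functional equation for the Mellin density. -/
lemma mellinDensity_one_sub {s : ℂ} (hs : s.im ≠ 0) :
    mellinDensity (1 - s) = 2 * π * (2 * π : ℂ) ^ (-s) * (2 * π : ℂ) ^ (-s) * Gamma s *
      riemannZeta s ^ 2 * (Complex.cos (π * s / 2) / Complex.sin (π * s / 2)) := by
  have h1 : ∀ n : ℕ, s ≠ -n := fun n h => hs (by simp [h])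
  have h2 : s ≠ 1 := fun h => hs (by simp [h])
  have hsin : Complex.sin (π * s) ≠ 0 := by
    intro h
    obtain ⟨k, hk⟩ := Complex.sin_eq_zero_iff.mp h
    have : (s : ℂ) = k := by
      have hpi : (π : ℂ) ≠ 0 := by exact_mod_cast Real.pi_ne_zero
      rw [mul_comm] at hk
      exact mul_right_cancel₀ hpi hk
    exact hs (by simp [this])
  have hdouble : Complex.sin (π * s) =
      2 * Complex.sin (π * s / 2) * Complex.cos (π * s / 2) := by
    rw [← Complex.sin_two_mul]
    congr 1
    ring
  rw [hdouble] at hsin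
  have hs1 : Complex.sin (π * s / 2) ≠ 0 := fun h => hsin (by simp [h])
  have hs2 : Complex.cos (π * s / 2) ≠ 0 := fun h => hsin (by simp [h])
  have hrefl := Complex.Gamma_mul_Gamma_one_sub s
  rw [hdouble] at hrefl
  have hG : Gamma (1 - s) * Gamma s * (2 * Complex.sin (π * s / 2) * Complex.cos (π * s / 2)) =
      π := by
    rw [mul_comm (Gamma (1 - s)), hrefl, div_mul_cancel₀ _ hsin]
  rw [mellinDensity, riemannZeta_one_sub h1 h2]
  generalize (2 * π : ℂ) ^ (-s) = q at *
  generalize Complex.sin (π * s / 2) = u at *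
  generalize Complex.cos (π * s / 2) = v at *
  rw [mul_div_assoc', eq_div_iff hs1]
  linear_combination (2 * q ^ 2 * Gamma s * v * riemannZeta s ^ 2) * hG

/-- Eight powers of decay from Γ against four powers of growth from ζ². -/
lemma exists_norm_mellinDensity_le_right (b : ℝ) :
    ∃ C, 0 ≤ C ∧ ∀ z : ℂ, -(1 / 2) ≤ z.re → z.re ≤ b → 1 ≤ |z.im| →
      ‖mellinDensity z‖ ≤ C / |z.im| ^ 4 := by
  obtain ⟨C1, h1, hC1⟩ := exists_norm_riemannZeta_le b
  obtain ⟨C2, h2, hC2⟩ := exists_norm_Gamma_le (-(1 / 2)) b 8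
  refine ⟨C2 * C1 ^ 2, by positivity, fun z k1 k2 k3 => ?_⟩
  have hy : 0 < |z.im| := zero_lt_one.trans_le k3
  rw [mellinDensity, norm_mul, norm_pow]
  calc ‖Gamma z‖ * ‖riemannZeta z‖ ^ 2 ≤ C2 / |z.im| ^ 8 * (C1 * |z.im| ^ 2) ^ 2 := by
        gcongr
        · exact hC2 z k1 k2 k3
        · exact hC1 z k1 k2 k3
    _ = _ := by field_simp

/-- The functional equation reflects z to s = 1 - z with Re s ≥ 5/4. There ζ, the powers of 2π and
the cotangent are all bounded, so Γ alone supplies the decay. -/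
lemma exists_norm_mellinDensity_le_left (a : ℝ) :
    ∃ C, 0 ≤ C ∧ ∀ z : ℂ, a ≤ z.re → z.re ≤ -(1 / 4) → 1 ≤ |z.im| →
      ‖mellinDensity z‖ ≤ C / |z.im| ^ 4 := by
  obtain ⟨C1, h1, hC1⟩ := exists_norm_riemannZeta_le_of_re
  obtain ⟨C2, h2, hC2⟩ := exists_norm_Gamma_le (1 + 1 / 4) (1 - a) 4
  refine ⟨2 * π * C2 * C1 ^ 2 * 2, by positivity, fun z k1 k2 k3 => ?_⟩
  have hy : 0 < |z.im| := zero_lt_one.trans_le k3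
  set s := 1 - z with hs
  have hz : z = 1 - s := by simp [hs]
  have him : |s.im| = |z.im| := by simp [hs]
  have hre : s.re = 1 - z.re := by simp [hs]
  rw [hz, mellinDensity_one_sub (by rw [← abs_pos, him]; exact hy), ← hz]
  have e0 : ‖(2 * π : ℂ) ^ (-s)‖ ≤ 1 := by
    have : (2 * π : ℂ) = ((2 * π : ℝ) : ℂ) := by push_cast; rfl
    rw [this, norm_cpow_eq_rpow_re_of_pos (by positivity)]
    refine Real.rpow_le_one_of_one_le_of_nonpos ?_ ?_
    · linarith [Real.pi_gt_three]
    · simp only [neg_re]; linarith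
  have e1 : ‖Complex.cos (π * s / 2) / Complex.sin (π * s / 2)‖ ≤ 2 := by
    rw [norm_div]
    refine div_le_of_le_mul₀ (norm_nonneg _) (by norm_num) (norm_cos_le_two_mul_norm_sin ?_)
    have : (π * s / 2 : ℂ).im = π / 2 * s.im := by
      rw [show (π * s / 2 : ℂ) = ((π / 2 : ℝ) : ℂ) * s by push_cast; ring, im_ofReal_mul]
    rw [this, abs_mul, abs_of_pos (by positivity), him]
    nlinarith [Real.pi_gt_three]
  have e2 := hC1 s (by linarith)
  have e3 := hC2 s (by linarith) (by linarith) (by rwa [him])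
  rw [him] at e3
  have e4 : ‖(2 * π : ℂ)‖ = 2 * π := by
    rw [norm_mul, Complex.norm_real, Real.norm_eq_abs, abs_of_pos Real.pi_pos]
    norm_num
  rw [norm_mul, norm_mul, norm_mul, norm_mul, norm_mul, norm_pow, e4]
  calc 2 * π * ‖(2 * π : ℂ) ^ (-s)‖ * ‖(2 * π : ℂ) ^ (-s)‖ * ‖Gamma s‖ * ‖riemannZeta s‖ ^ 2 *
        ‖Complex.cos (π * s / 2) / Complex.sin (π * s / 2)‖
      ≤ 2 * π * 1 * 1 * (C2 / |z.im| ^ 4) * C1 ^ 2 * 2 := by gcongr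
    _ = _ := by ring

/-- Decay of the Mellin density in vertical strips. -/
lemma exists_norm_mellinDensity_le (a b : ℝ) :
    ∃ C, 0 ≤ C ∧ ∀ z : ℂ, a ≤ z.re → z.re ≤ b → 1 ≤ |z.im| →
      ‖mellinDensity z‖ ≤ C / |z.im| ^ 4 := by
  obtain ⟨C1, h1, hC1⟩ := exists_norm_mellinDensity_le_left a
  obtain ⟨C2, h2, hC2⟩ := exists_norm_mellinDensity_le_right b
  refine ⟨C1 + C2, by positivity, fun z k1 k2 k3 => ?_⟩
  rw [add_div]
  rcases le_total z.re (-(1 / 4)) with h | h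
  · exact (hC1 z k1 h k3).trans (le_add_of_nonneg_right (by positivity))
  · exact (hC2 z (by linarith) k2 k3).trans (le_add_of_nonneg_left (by positivity))

end DirichletGraph

/-! ### Residues of the Mellin integrand and the shift of the contour. -/

namespace DirichletGraph

open Complex MeasureTheory Filter Set

lemma norm_cpow_neg_le {t : ℝ} (ht : 0 < t) {a b : ℝ} {z : ℂ} (h1 : a ≤ z.re) (h2 : z.re ≤ b) :
    ‖(t : ℂ) ^ (-z)‖ ≤ t ^ (-a) + t ^ (-b) := by
  rw [norm_cpow_eq_rpow_re_of_pos ht, neg_re]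
  have p1 := (Real.rpow_pos_of_pos ht (-a)).le
  have p2 := (Real.rpow_pos_of_pos ht (-b)).le
  rcases le_total 1 t with h | h
  · exact (Real.rpow_le_rpow_of_exponent_le h (by linarith)).trans (le_add_of_nonneg_right p2)
  · exact (Real.rpow_le_rpow_of_exponent_ge ht h (by linarith)).trans (le_add_of_nonneg_left p1)

/-- The integrand of the remainder decays in vertical strips, also after multiplication by a
polynomial of degree two. -/
lemma exists_norm_integrand_le {t : ℝ} (ht : 0 < t) (a b p : ℝ) :
    ∃ C, 0 ≤ C ∧ ∀ z : ℂ, a ≤ z.re → z.re ≤ b → 1 ≤ |z.im| → ∀ j ≤ 2,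
      ‖(z - p) ^ j * ((t : ℂ) ^ (-z) * mellinDensity z)‖ ≤ C / |z.im| ^ 2 := by
  obtain ⟨C, h0, hC⟩ := exists_norm_mellinDensity_le a b
  set M : ℝ := |a| + |b| + |p|
  set T : ℝ := t ^ (-a) + t ^ (-b)
  have hM0 : 0 ≤ M := by positivity
  have hT0 : 0 ≤ T := by positivity
  refine ⟨(M + 1) ^ 2 * (T * C), by positivity, fun z h1 h2 h3 j hj => ?_⟩
  have hy : 0 < |z.im| := zero_lt_one.trans_le h3
  have hz : ‖z - p‖ ≤ (M + 1) * |z.im| := by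
    have := norm_le_mul_abs_im (z := z - p) (M := M) (by
      simp only [sub_re, ofReal_re, M]
      rw [abs_le]
      constructor <;> cases abs_cases a <;> cases abs_cases b <;> cases abs_cases p <;> linarith)
      (by simpa using h3)
    simpa using this
  have hw : 1 ≤ (M + 1) * |z.im| := by nlinarith
  have hzj : ‖z - p‖ ^ j ≤ ((M + 1) * |z.im|) ^ 2 :=
    (pow_le_pow_left₀ (norm_nonneg _) hz j).trans (pow_le_pow_right₀ hw hj)
  rw [norm_mul, norm_pow, norm_mul]
  calc ‖z - p‖ ^ j * (‖(t : ℂ) ^ (-z)‖ * ‖mellinDensity z‖)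
      ≤ ((M + 1) * |z.im|) ^ 2 * (T * (C / |z.im| ^ 4)) := by
        gcongr
        · exact norm_cpow_neg_le ht h1 h2
        · exact hC z h1 h2 h3
    _ = _ := by field_simp

lemma differentiableAt_mellinDensity {z : ℂ} (h1 : z ≠ 1) (h0 : ∀ n : ℕ, z ≠ -n) :
    DifferentiableAt ℂ mellinDensity z :=
  (differentiableAt_Gamma z h0).mul ((differentiableAt_riemannZeta h1).pow 2)

lemma ne_of_re_line {κ : ℝ} (h1 : κ ≠ 1) (h0 : ∀ n : ℕ, κ ≠ -n) (y : ℝ) :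
    (κ : ℂ) + y * I ≠ 1 ∧ ∀ n : ℕ, (κ : ℂ) + y * I ≠ -n := by
  refine ⟨fun h => h1 ?_, fun n h => h0 n ?_⟩ <;>
  · have := congrArg Complex.re h
    simpa using this

lemma continuous_mellinDensity_line {κ : ℝ} (h1 : κ ≠ 1) (h0 : ∀ n : ℕ, κ ≠ -n) :
    Continuous fun y : ℝ => mellinDensity (κ + y * I) := by
  rw [continuous_iff_continuousAt]
  intro y
  obtain ⟨k1, k2⟩ := ne_of_re_line h1 h0 y
  exact ContinuousAt.comp (f := fun y : ℝ => (κ : ℂ) + y * I)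
    (differentiableAt_mellinDensity k1 k2).continuousAt (by fun_prop)

lemma verticalIntegrable_mellinDensity {κ : ℝ} (h1 : κ ≠ 1) (h0 : ∀ n : ℕ, κ ≠ -n) :
    VerticalIntegrable mellinDensity κ := by
  obtain ⟨C, hC0, hC⟩ := exists_norm_integrand_le one_pos κ κ 0
  refine integrable_of_le_inv_sq (continuous_mellinDensity_line h1 h0) (C := C) fun y hy => ?_
  simpa using hC (κ + y * I) (by simp) (by simp) (by simpa) 0 (by norm_num)

/-- The difference of two remainders is the residue at the simple pole between the two
lines. -/
lemma remainder_sub_of_pole {A : ℂ → ℂ} {a b p t : ℝ} (ht : 0 < t) (hap : a < p) (hpb : p < b)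
    (hA : DifferentiableOn ℂ A {z | a ≤ z.re ∧ z.re ≤ b})
    (hAm : ∀ z : ℂ, a ≤ z.re → z.re ≤ b → z ≠ p →
      A z = (z - p) * ((t : ℂ) ^ (-z) * mellinDensity z)) :
    remainder b t - remainder a t = A p := by
  obtain ⟨C, hC0, hC⟩ := exists_norm_integrand_le ht a b p
  have hne : ∀ z : ℂ, 1 ≤ |z.im| → z ≠ p := fun z hz h => by
    rw [h] at hz
    simp at hz
    linarith
  have hres := verticalIntegral_sub_eq_residue (C := C) hap hpb hA fun z h1 h2 h3 => by
    have := hC z h1 h2 h3 1 (by norm_num)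
    rw [pow_one, ← hAm z h1 h2 (hne z h3)] at this
    refine this.trans ?_
    gcongr
    nlinarith
  have key : ∀ σ : ℝ, a ≤ σ → σ ≤ b → σ ≠ p →
      remainder σ t = (2 * π)⁻¹ * ∫ y : ℝ, A (σ + y * I) / (σ + y * I - p) := by
    intro σ h1 h2 h3
    rw [remainder, mellinInv, ← coe_smul, smul_eq_mul]
    push_cast
    rw [one_div]
    congr 2
    ext y
    have hz : (σ : ℂ) + y * I ≠ p := fun h => by
      have := congrArg Complex.re h
      simp at this
      exact h3 this
    rw [hAm _ (by simpa) (by simpa) hz, mul_div_cancel_left₀ _ (sub_ne_zero.mpr hz), smul_eq_mul]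
  have hpi : (π : ℂ) ≠ 0 := by exact_mod_cast Real.pi_ne_zero
  rw [key b (hap.trans hpb).le le_rfl hpb.ne', key a le_rfl (hap.trans hpb).le hap.ne,
    ← mul_sub, hres]
  push_cast
  field_simp

lemma remainder_sub_of_double_pole {A : ℂ → ℂ} {a b p t : ℝ} (ht : 0 < t) (hap : a < p)
    (hpb : p < b) (hA : DifferentiableOn ℂ A {z | a ≤ z.re ∧ z.re ≤ b})
    (hAm : ∀ z : ℂ, a ≤ z.re → z.re ≤ b → z ≠ p →
      A z = (z - p) ^ 2 * ((t : ℂ) ^ (-z) * mellinDensity z)) :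
    remainder b t - remainder a t = deriv A p := by
  obtain ⟨C, hC0, hC⟩ := exists_norm_integrand_le ht a b p
  have hne : ∀ z : ℂ, 1 ≤ |z.im| → z ≠ p := fun z hz h => by
    rw [h] at hz
    simp at hz
    linarith
  have hres := verticalIntegral_sub_eq_residue_double (C := C) hap hpb hA fun z h1 h2 h3 => by
    have := hC z h1 h2 h3 2 le_rfl
    rw [← hAm z h1 h2 (hne z h3)] at this
    refine this.trans ?_
    gcongr
    nlinarith
  have key : ∀ σ : ℝ, a ≤ σ → σ ≤ b → σ ≠ p →
      remainder σ t = (2 * π)⁻¹ * ∫ y : ℝ, A (σ + y * I) / (σ + y * I - p) ^ 2 := by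
    intro σ h1 h2 h3
    rw [remainder, mellinInv, ← coe_smul, smul_eq_mul]
    push_cast
    rw [one_div]
    congr 2
    ext y
    have hz : (σ : ℂ) + y * I ≠ p := fun h => by
      have := congrArg Complex.re h
      simp at this
      exact h3 this
    rw [hAm _ (by simpa) (by simpa) hz,
      mul_div_cancel_left₀ _ (pow_ne_zero 2 (sub_ne_zero.mpr hz)), smul_eq_mul]
  have hpi : (π : ℂ) ≠ 0 := by exact_mod_cast Real.pi_ne_zero
  rw [key b (hap.trans hpb).le le_rfl hpb.ne', key a le_rfl (hap.trans hpb).le hap.ne,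
    ← mul_sub, hres]
  push_cast
  field_simp

lemma Gamma_add_nat_eq_prod_mul (N : ℕ) {z : ℂ} (hz : ∀ n : ℕ, z ≠ -n) :
    Gamma (z + N) = (∏ k ∈ Finset.range N, (z + k)) * Gamma z := by
  induction N with
  | zero => simp
  | succ N ih =>
    have h : z + N ≠ 0 := fun h => hz N (eq_neg_of_add_eq_zero_left h)
    rw [Finset.prod_range_succ, Nat.cast_succ, ← add_assoc, Gamma_add_one _ h, ih]
    ring

/-- This is the denominator in the residue (-1)^N/N! of Γ at -N. -/
lemma prod_range_neg_add (N : ℕ) :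
    ∏ k ∈ Finset.range N, (-(N : ℂ) + k) = (-1) ^ N * N.factorial := by
  rw [← Finset.prod_range_add_one_eq_factorial, ← Finset.prod_range_reflect, Nat.cast_prod,
    ← Finset.card_range N, ← Finset.prod_const, Finset.card_range, ← Finset.prod_mul_distrib]
  refine Finset.prod_congr rfl fun k hk => ?_
  have : k + 1 ≤ N := Finset.mem_range.mp hk
  rw [Nat.sub_sub, Nat.cast_sub (by omega)]
  push_cast
  ring

/-- The residue at -N is t^N (-1)^N/N! · ζ(-N)² with ζ(-N) = (-1)^N B_{N+1}/(N+1). -/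
lemma remainder_sub_remainder {a b t : ℝ} (ht : 0 < t) (N : ℕ) (ha1 : -(N : ℝ) - 1 < a)
    (ha : a < -(N : ℝ)) (hb : -(N : ℝ) < b) (hb1 : b < -(N : ℝ) + 1) :
    remainder b t - remainder a t = ((coeff N * (-t) ^ N : ℝ) : ℂ) := by
  have ht' : (t : ℂ) ≠ 0 := by exact_mod_cast ht.ne'
  -- The pole is removed through (z+N)Γ(z) = Γ(z+N+1)/(z(z+1)⋯(z+N-1)), which is regular in the
  -- strip.
  set A : ℂ → ℂ := fun z => (t : ℂ) ^ (-z) *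
    (Gamma (z + (N + 1 : ℕ)) / (∏ k ∈ Finset.range N, (z + k)) * riemannZeta z ^ 2) with hAdef
  have hprod : ∀ z : ℂ, z.re ≤ b → ∏ k ∈ Finset.range N, (z + k) ≠ 0 := by
    intro z hz
    rw [Finset.prod_ne_zero_iff]
    intro k hk h
    have h1 := congrArg Complex.re h
    simp at h1
    have h2 : (k : ℝ) + 1 ≤ N := by exact_mod_cast Finset.mem_range.mp hk
    linarith
  have hb' : b < 1 := by
    have : (0 : ℝ) ≤ N := N.cast_nonneg
    linarith
  have h := remainder_sub_of_pole (A := A) (p := -(N : ℝ)) ht ha hb ?_ ?_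
  · rw [h, hAdef]
    simp only [ofReal_neg, ofReal_natCast, neg_neg]
    rw [prod_range_neg_add, riemannZeta_neg_nat_eq_bernoulli]
    simp only [coeff, Nat.cast_add, Nat.cast_one, neg_add_cancel_left, Gamma_one,
      Nat.factorial_succ]
    have h1 : ((N : ℂ) + 1) ≠ 0 := by exact_mod_cast N.succ_ne_zero
    have h2 : (N.factorial : ℂ) ≠ 0 := by exact_mod_cast N.factorial_ne_zero
    have h3 : ((-1 : ℂ) ^ N) ^ 2 = 1 := by rw [← pow_mul, mul_comm, pow_mul]; simp
    push_cast
    rw [cpow_natCast, neg_pow (t : ℂ) N]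
    have h4 : (-1 : ℂ) ^ N ≠ 0 := pow_ne_zero _ (by norm_num)
    field_simp
  · intro z hz
    have e1 : DifferentiableAt ℂ (fun z : ℂ => (t : ℂ) ^ (-z)) z :=
      (differentiableAt_id.neg).const_cpow (Or.inl ht')
    have e2 : DifferentiableAt ℂ (fun z : ℂ => Gamma (z + (N + 1 : ℕ))) z := by
      refine DifferentiableAt.comp z (differentiableAt_Gamma _ fun m hm => ?_) (by fun_prop)
      have := congrArg Complex.re hm
      simp at this
      have hm0 : (0 : ℝ) ≤ m := m.cast_nonneg
      linarith [hz.1]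
    have e3 : DifferentiableAt ℂ (fun z : ℂ => ∏ k ∈ Finset.range N, (z + k)) z := by
      fun_prop
    have e4 : DifferentiableAt ℂ riemannZeta z := differentiableAt_riemannZeta fun h => by
      have := hz.2
      rw [h] at this
      simp at this
      linarith
    exact (e1.mul ((e2.div e3 (hprod z hz.2)).mul (e4.pow 2))).differentiableWithinAt
  · intro z h1 h2 h3
    have hz : ∀ n : ℕ, z ≠ -n := by
      intro n hn
      rw [hn] at h1 h2 h3
      simp at h1 h2 h3
      have k1 : (n : ℝ) < N + 1 := by linarith
      have k2 : (N : ℝ) < n + 1 := by linarith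
      have k1' : n < N + 1 := by exact_mod_cast k1
      have k2' : N < n + 1 := by exact_mod_cast k2
      exact h3 (by exact_mod_cast (by omega : n = N))
    have hp := hprod z h2
    simp only [hAdef, mellinDensity]
    rw [Gamma_add_nat_eq_prod_mul _ hz, Finset.prod_range_succ]
    push_cast
    field_simp
    ring

/-- The derivative of t^(-z) Γ(z) ((z-1)ζ(z))² at 1 is (-ln t + Γ'(1) + 2γ)/t, and Γ'(1) = -γ. -/
lemma remainder_two_sub {t : ℝ} (ht : 0 < t) :
    remainder 2 t - remainder (1 / 2) t =
      ((-Real.log t / t + Real.eulerMascheroniConstant / t : ℝ) : ℂ) := by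
  have ht' : (t : ℂ) ≠ 0 := by exact_mod_cast ht.ne'
  set A : ℂ → ℂ := fun z => (t : ℂ) ^ (-z) * (Gamma z * riemannZeta₁ z ^ 2) with hAdef
  have h := remainder_sub_of_double_pole (A := A) (p := 1) (a := 1 / 2) (b := 2) ht
    (by norm_num) (by norm_num) ?_ ?_
  · rw [h]
    have d1 : HasDerivAt (fun z : ℂ => (t : ℂ) ^ (-z)) ((t : ℂ) ^ (-1 : ℂ) * Complex.log t * -1) 1 :=
      ((hasDerivAt_id (1 : ℂ)).neg).const_cpow (Or.inl ht')
    have d2 : HasDerivAt riemannZeta₁ (Real.eulerMascheroniConstant : ℂ) 1 := by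
      rw [← deriv_riemannZeta₁_one]
      exact differentiable_riemannZeta₁.differentiableAt.hasDerivAt
    have d3 := (d1.mul (hasDerivAt_Gamma_one.mul (d2.pow 2))).deriv
    rw [ofReal_one]
    refine d3.trans ?_
    simp only [Pi.mul_apply, Pi.pow_apply, riemannZeta₁_one, Gamma_one, cpow_neg_one,
      ← ofReal_log ht.le]
    push_cast
    field_simp
    ring
  · intro z hz
    have e1 : DifferentiableAt ℂ (fun z : ℂ => (t : ℂ) ^ (-z)) z :=
      (differentiableAt_id.neg).const_cpow (Or.inl ht')
    have e2 : DifferentiableAt ℂ Gamma z := differentiableAt_Gamma _ fun m hm => by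
      have := hz.1
      rw [hm] at this
      simp at this
      have hm0 : (0 : ℝ) ≤ m := m.cast_nonneg
      linarith
    exact (e1.mul (e2.mul
      (differentiable_riemannZeta₁.differentiableAt.pow 2))).differentiableWithinAt
  · intro z h1 h2 h3
    have h3' : z ≠ 1 := by simpa using h3
    have := sub_ne_zero.mpr h3'
    simp only [hAdef, mellinDensity]
    rw [riemannZeta_eq_inv_sub_mul h3']
    push_cast
    field_simp

lemma remainder_eq_of_zero_strip {a t : ℝ} (ht : 0 < t) (ha : a < 0) (ha1 : -1 < a) :
    remainder 2 t = (truncation 0 t : ℂ) + remainder a t := by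
  have h1 := remainder_two_sub ht
  have h2 := remainder_sub_remainder (a := a) (b := 1 / 2) ht 0 (by simpa using ha1) (by simpa)
    (by norm_num) (by norm_num)
  -- The constant 1/4 is the residue at 0, the term m = 0 of the Bernoulli family, with B_1² = 1/4.
  have h3 : coeff 0 = 1 / 4 := by
    simp [coeff]
    norm_num
  rw [h3] at h2
  simp only [truncation]
  simp at h1 h2 ⊢
  linear_combination h1 + h2

/-- The contour in the representation of `Θ` can be moved to the left, at the cost of the
residues. -/
lemma remainder_two_eq {t : ℝ} (ht : 0 < t) (N : ℕ) {κ : ℝ} (h1 : -(N : ℝ) - 1 < κ)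
    (h2 : κ < -(N : ℝ)) : remainder 2 t = (truncation N t : ℂ) + remainder κ t := by
  induction N generalizing κ with
  | zero => exact remainder_eq_of_zero_strip ht (by simpa using h2) (by simpa using h1)
  | succ N ih =>
    have h3 := ih (κ := -(N : ℝ) - 1 / 2) (by linarith) (by linarith)
    push_cast at h1 h2
    have h4 := remainder_sub_remainder (a := κ) (b := -(N : ℝ) - 1 / 2) ht (N + 1)
      (by push_cast; linarith) (by push_cast; linarith) (by push_cast; linarith)
      (by push_cast; linarith)
    have h5 : truncation (N + 1) t = truncation N t + coeff (N + 1) * (-t) ^ (N + 1) := by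
      simp only [truncation]
      rw [Finset.sum_Icc_succ_top (by omega)]
      ring
    rw [h5, h3, ofReal_add, ← h4]
    ring

end DirichletGraph

/-! ### The Mellin representation of Θ and its asymptotic expansion. -/

namespace DirichletGraph

open Complex MeasureTheory Filter Set
open scoped LSeries.notation

/-- The divisor function is the Dirichlet convolution of 1 with itself. The real series serves the
interchange of sum and integral. -/
lemma hasSum_card_divisors_mul_cpow {z : ℂ} (hz : 1 < z.re) :
    HasSum (fun n : ℕ => (n.divisors.card : ℂ) * (n : ℂ) ^ (-z)) (riemannZeta z ^ 2) ∧
      Summable fun n : ℕ => (n.divisors.card : ℝ) * (n : ℝ) ^ (-z.re) := by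
  have h1 := LSeriesHasSum_one hz
  have h := h1.convolution h1
  have e : LSeries.term (1 ⍟ 1) z = fun n : ℕ => (n.divisors.card : ℂ) * (n : ℂ) ^ (-z) := by
    ext n
    rcases eq_or_ne n 0 with rfl | hn
    · simp
    · rw [LSeries.term_of_ne_zero hn, LSeries.convolution_def, cpow_neg, div_eq_mul_inv]
      congr 1
      have := Nat.sum_divisorsAntidiagonal (n := n) fun _ _ => (1 : ℂ)
      simpa using this
  rw [LSeriesHasSum, e, ← sq] at h
  refine ⟨h, h.summable.norm.congr fun n => ?_⟩
  rcases eq_or_ne n 0 with rfl | hn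
  · simp
  · rw [norm_mul, norm_natCast_cpow_of_pos (Nat.pos_of_ne_zero hn)]
    simp

lemma summable_card_divisors_mul_exp {t : ℝ} (ht : 0 < t) :
    Summable fun n : ℕ => (n.divisors.card : ℝ) * Real.exp (-(n : ℝ) * t) := by
  have h := Real.summable_pow_mul_exp_neg_nat_mul 1 ht
  refine h.of_nonneg_of_le (fun n => by positivity) fun n => ?_
  rw [pow_one]
  have : (n.divisors.card : ℝ) ≤ n := by exact_mod_cast Nat.card_divisors_le_self n
  rw [neg_mul, neg_mul, mul_comm (n : ℝ) t]
  gcongr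

lemma mellin_exp_neg_eq_Gamma {z : ℂ} (hz : 0 < z.re) :
    mellin (fun x : ℝ => ((Real.exp (-x) : ℝ) : ℂ)) z = Gamma z := by
  rw [Gamma_eq_integral hz, GammaIntegral_eq_mellin]

lemma verticalIntegrable_Gamma_two : VerticalIntegrable Gamma 2 := by
  obtain ⟨C, hC0, hC⟩ := exists_norm_Gamma_le 2 2 2
  refine integrable_of_le_inv_sq (C := C) ?_ fun y hy => ?_
  · rw [continuous_iff_continuousAt]
    intro y
    refine ContinuousAt.comp (f := fun y : ℝ => ((2 : ℝ) : ℂ) + y * I)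
      (differentiableAt_Gamma _ fun n h => ?_).continuousAt (by fun_prop)
    have := congrArg Complex.re h
    simp at this
    linarith [(n.cast_nonneg : (0 : ℝ) ≤ n)]
  · simpa using hC ((2 : ℝ) + y * I) (by simp) (by simp) (by simpa)

/-- The Cahen–Mellin integral. -/
lemma exp_neg_eq_integral {x : ℝ} (hx : 0 < x) :
    ((Real.exp (-x) : ℝ) : ℂ) =
      (2 * π : ℝ)⁻¹ * ∫ y : ℝ, (x : ℂ) ^ (-((2 : ℝ) + y * I : ℂ)) * Gamma ((2 : ℝ) + y * I) := by
  have hm : ∀ y : ℝ, mellin (fun x : ℝ => ((Real.exp (-x) : ℝ) : ℂ)) ((2 : ℝ) + y * I) =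
      Gamma ((2 : ℝ) + y * I) := fun y => mellin_exp_neg_eq_Gamma (by simp)
  have h := mellinInv_mellin_eq 2 (fun x : ℝ => ((Real.exp (-x) : ℝ) : ℂ)) hx ?_ ?_ ?_
  · rw [← h, mellinInv, ← coe_smul, smul_eq_mul, one_div]
    simp only [hm, smul_eq_mul]
  · have := Complex.GammaIntegral_convergent (s := 2) (by simp)
    rw [MellinConvergent]
    refine this.congr_fun (fun x _ => ?_) measurableSet_Ioi
    simp [mul_comm]
  · have := verticalIntegrable_Gamma_two
    rw [VerticalIntegrable] at this ⊢
    exact this.congr (ae_of_all _ fun y => (hm y).symm)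
  · fun_prop

/-- On Re z = 2 the L¹ norms of the terms are a constant times d(n)/n², so the sum may be taken
under the integral. -/
lemma Theta_eq_remainder_two {t : ℝ} (ht : 0 < t) : (Theta t : ℂ) = remainder 2 t := by
  set F : ℕ → ℝ → ℂ := fun n y => (n.divisors.card : ℂ) * (((n * t : ℝ) : ℂ) ^
    (-((2 : ℝ) + y * I : ℂ)) * Gamma ((2 : ℝ) + y * I)) with hF
  have hd := hasSum_card_divisors_mul_cpow (z := 2) (by simp)
  have hcpow : ∀ (n : ℕ) (z : ℂ), (n.divisors.card : ℂ) * ((n * t : ℝ) : ℂ) ^ (-z) =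
      (t : ℂ) ^ (-z) * ((n.divisors.card : ℂ) * (n : ℂ) ^ (-z)) := by
    intro n z
    rw [ofReal_mul, mul_cpow_ofReal_nonneg n.cast_nonneg ht.le, ofReal_natCast]
    ring
  have hFn : ∀ n y, F n y = (t : ℂ) ^ (-((2 : ℝ) + y * I : ℂ)) * Gamma ((2 : ℝ) + y * I) *
      ((n.divisors.card : ℂ) * (n : ℂ) ^ (-((2 : ℝ) + y * I : ℂ))) := by
    intro n y
    simp only [hF]
    rw [← mul_assoc, hcpow]
    ring
  have hnorm : ∀ n y, ‖F n y‖ = (n.divisors.card : ℝ) * (n : ℝ) ^ (-2 : ℝ) *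
      (t ^ (-2 : ℝ) * ‖Gamma ((2 : ℝ) + y * I)‖) := by
    intro n y
    rw [hFn]
    rcases eq_or_ne n 0 with rfl | hn
    · simp
    · rw [norm_mul, norm_mul, norm_mul, norm_cpow_eq_rpow_re_of_pos ht,
        norm_natCast_cpow_of_pos (Nat.pos_of_ne_zero hn)]
      simp
      ring
  have hG := verticalIntegrable_Gamma_two
  have hint : ∀ n, Integrable (F n) := by
    intro n
    have hc : Continuous fun y : ℝ => (t : ℂ) ^ (-((2 : ℝ) + y * I : ℂ)) *
        ((n.divisors.card : ℂ) * (n : ℂ) ^ (-((2 : ℝ) + y * I : ℂ))) := by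
      rcases eq_or_ne n 0 with rfl | hn
      · simpa using continuous_const
      · have h1 : (t : ℂ) ≠ 0 := by exact_mod_cast ht.ne'
        have h2 : (n : ℂ) ≠ 0 := by exact_mod_cast hn
        refine Continuous.mul ?_ (continuous_const.mul ?_)
        · exact Continuous.const_cpow (by fun_prop) (Or.inl h1)
        · exact Continuous.const_cpow (by fun_prop) (Or.inl h2)
    refine (hG.norm.const_mul ((n.divisors.card : ℝ) * (n : ℝ) ^ (-2 : ℝ) * t ^ (-2 : ℝ))).mono' ?_
      (ae_of_all _ fun y => ?_)
    · refine (hc.aestronglyMeasurable.mul hG.aestronglyMeasurable).congr (ae_of_all _ fun y => ?_)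
      simp only [Pi.mul_apply]
      rw [hFn]
      ring
    · rw [hnorm]
      exact le_of_eq (by ring)
  have hsum : Summable fun n => ∫ y, ‖F n y‖ := by
    simp only [hnorm, integral_const_mul]
    have := hd.2.mul_right (t ^ (-2 : ℝ) * ∫ y : ℝ, ‖Gamma ((2 : ℝ) + y * I)‖)
    simpa using this
  have h1 := (hasSum_integral_of_summable_integral_norm hint hsum).mul_left ((2 * π : ℝ)⁻¹ : ℂ)
  have h2 : ∀ n : ℕ, ((2 * π : ℝ)⁻¹ : ℂ) * ∫ y, F n y =
      (((n.divisors.card : ℝ) * Real.exp (-(n : ℝ) * t) : ℝ) : ℂ) := by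
    intro n
    rcases eq_or_ne n 0 with rfl | hn
    · simp [hF]
    · have hn0 : (0 : ℝ) < n := by exact_mod_cast Nat.pos_of_ne_zero hn
      simp only [hF]
      rw [integral_const_mul, neg_mul, ofReal_mul (n.divisors.card : ℝ) (Real.exp _),
        exp_neg_eq_integral (mul_pos hn0 ht)]
      push_cast
      ring
  simp only [h2] at h1
  have h3 := (hasSum_ofReal.mpr (summable_card_divisors_mul_exp ht).hasSum).unique h1
  rw [Theta, h3, remainder, mellinInv, ← coe_smul, smul_eq_mul, one_div]
  push_cast
  congr 2
  ext y
  have hz := (hasSum_card_divisors_mul_cpow (z := (2 : ℝ) + y * I) (by simp)).1.tsum_eq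
  push_cast at hz
  simp only [hFn]
  push_cast
  rw [tsum_mul_left, hz, mellinDensity, smul_eq_mul]
  ring

/-- The exact formula for `Θ`. -/
lemma Theta_eq_truncation_add_remainder {t : ℝ} (ht : 0 < t) (N : ℕ) {κ : ℝ}
    (h1 : -(N : ℝ) - 1 < κ) (h2 : κ < -(N : ℝ)) :
    (Theta t : ℂ) = (truncation N t : ℂ) + remainder κ t := by
  rw [Theta_eq_remainder_two ht, remainder_two_eq ht N h1 h2]

/-- On the line |t^(-z)| = t^(-κ) is constant and leaves the integral. -/
lemma exists_norm_remainder_le (κ : ℝ) : ∃ C, ∀ t : ℝ, 0 < t → ‖remainder κ t‖ ≤ C * t ^ (-κ) := by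
  refine ⟨(2 * π)⁻¹ * ∫ y : ℝ, ‖mellinDensity (κ + y * I)‖, fun t ht => ?_⟩
  rw [remainder, mellinInv, norm_smul, one_div, Real.norm_of_nonneg (by positivity), mul_assoc]
  refine mul_le_mul_of_nonneg_left ?_ (by positivity)
  rw [mul_comm, ← integral_const_mul]
  refine (norm_integral_le_integral_norm _).trans_eq ?_
  congr 1
  ext y
  rw [norm_smul, norm_cpow_eq_rpow_re_of_pos ht]
  simp

lemma Theta_sub_truncation_isLittleO (N : ℕ) :
    (fun t : ℝ => Theta t - truncation N t) =o[𝓝[>] (0 : ℝ)] fun t : ℝ => t ^ N := by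
  have hpow : ∀ s : ℝ, N < s → (fun t : ℝ => t ^ s) =o[𝓝[>] (0 : ℝ)] fun t : ℝ => t ^ N := by
    intro s hs
    rw [Asymptotics.isLittleO_iff_tendsto']
    · have h0 : Tendsto (fun t : ℝ => t ^ (s - N)) (𝓝[>] 0) (𝓝 0) := by
        have := (Real.continuousAt_rpow_const 0 (s - N) (Or.inr (by linarith))).tendsto
        rw [Real.zero_rpow (by linarith)] at this
        exact this.mono_left nhdsWithin_le_nhds
      refine h0.congr' ?_
      filter_upwards [self_mem_nhdsWithin] with t ht
      rw [Real.rpow_sub ht, Real.rpow_natCast]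
    · filter_upwards [self_mem_nhdsWithin] with t ht h
      exact absurd h (pow_ne_zero _ (ne_of_gt ht))
  -- The middle of the strip after N residues yields an error O(t^(N+1/2)).
  obtain ⟨C, hC⟩ := exists_norm_remainder_le (-(N : ℝ) - 1 / 2)
  refine Asymptotics.IsBigO.trans_isLittleO ?_ (hpow (N + 1 / 2) (by linarith))
  refine Asymptotics.IsBigO.of_bound C ?_
  filter_upwards [self_mem_nhdsWithin] with t ht
  have ht' : 0 < t := ht
  have h := Theta_eq_truncation_add_remainder ht' N (κ := -(N : ℝ) - 1 / 2) (by linarith)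
    (by linarith)
  have h2 : ((Theta t - truncation N t : ℝ) : ℂ) = remainder (-(N : ℝ) - 1 / 2) t := by
    push_cast
    rw [h]
    ring
  rw [← Complex.norm_real, h2, Real.norm_of_nonneg (by positivity)]
  refine (hC t ht').trans_eq ?_
  congr 2
  ring

/-! ### Growth of the Bernoulli coefficients and divergence. -/

lemma coeff_nonneg (m : ℕ) : 0 ≤ coeff m := by
  unfold coeff
  positivity

lemma coeff_two_mul {k : ℕ} (hk : k ≠ 0) : coeff (2 * k) = 0 := by
  have : bernoulli (2 * k + 1) = 0 :=
    bernoulli_eq_zero_of_odd (odd_two_mul_add_one k) (by omega)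
  simp [coeff, this]

/-- Even powers drop out because odd Bernoulli numbers beyond B_1 vanish. Without cancellation,
large terms force the partial sums to diverge. -/
lemma coeff_mul_neg_pow_nonpos {t : ℝ} (ht : 0 < t) {m : ℕ} (hm : 1 ≤ m) :
    coeff m * (-t) ^ m ≤ 0 := by
  rcases Nat.even_or_odd' m with ⟨k, rfl | rfl⟩
  · rw [coeff_two_mul (by omega), zero_mul]
  · rw [(odd_two_mul_add_one k).neg_pow]
    have := mul_nonneg (coeff_nonneg (2 * k + 1)) (pow_nonneg ht.le (2 * k + 1))
    linarith

/-- The even Bernoulli numbers are large. -/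
lemma factorial_le_abs_bernoulli {k : ℕ} (hk : k ≠ 0) :
    ((2 * k).factorial : ℝ) / (2 * π) ^ (2 * k) ≤ |((bernoulli (2 * k) : ℚ) : ℝ)| := by
  have h := hasSum_zeta_nat hk
  have h1 : (1 : ℝ) ≤ (-1) ^ (k + 1) * 2 ^ (2 * k - 1) * π ^ (2 * k) *
      bernoulli (2 * k) / (2 * k).factorial := by
    -- Only the term n = 1 of the series for ζ(2k) is kept.
    have := le_hasSum h 1 fun n _ => by positivity
    simpa using this
  have h2 := h1.trans (le_abs_self _)
  rw [abs_div, abs_mul, abs_mul, abs_mul, abs_pow, abs_neg, abs_one, one_pow, one_mul,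
    abs_of_pos (show (0 : ℝ) < 2 ^ (2 * k - 1) by positivity),
    abs_of_pos (show (0 : ℝ) < π ^ (2 * k) by positivity), Nat.abs_cast,
    le_div_iff₀ (by positivity), one_mul] at h2
  rw [div_le_iff₀ (by positivity)]
  refine h2.trans ?_
  rw [mul_pow, mul_comm |_|]
  gcongr
  · norm_num
  · omega

/-- Squaring the Bernoulli bound gives two factorials and the denominator removes only one. What
remains is a factorial over a geometric sequence of ratio q. -/
lemma tendsto_coeff_mul_pow {r : ℝ} (hr : 0 < r) :
    Tendsto (fun k : ℕ => coeff (2 * k + 1) * r ^ (2 * k + 1)) atTop atTop := by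
  set q : ℝ := (2 * π) ^ 2 / r with hq
  have hq0 : 0 < q := by positivity
  have hlow : ∀ k : ℕ, ((2 * k + 1).factorial : ℝ) / q ^ (2 * k + 1) / (2 * π) ^ 2 ≤
      coeff (2 * k + 1) * r ^ (2 * k + 1) := by
    intro k
    have hb := factorial_le_abs_bernoulli (k := k + 1) (by omega)
    have hb2 := pow_le_pow_left₀ (by positivity) hb 2
    rw [sq_abs] at hb2
    rw [coeff, show 2 * k + 1 + 1 = 2 * (k + 1) by ring]
    have hc : (((2 * k + 1 : ℕ) : ℝ) + 1) = ((2 * (k + 1) : ℕ) : ℝ) := by push_cast; ring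
    rw [hc]
    calc ((2 * k + 1).factorial : ℝ) / q ^ (2 * k + 1) / (2 * π) ^ 2
        = (((2 * (k + 1)).factorial : ℝ) / (2 * π) ^ (2 * (k + 1))) ^ 2 /
          (((2 * (k + 1) : ℕ) : ℝ) * ((2 * (k + 1)).factorial : ℝ)) * r ^ (2 * k + 1) := by
          rw [show 2 * (k + 1) = (2 * k + 1) + 1 by ring, Nat.factorial_succ (2 * k + 1), hq]
          push_cast
          have hf : ((2 * k + 1).factorial : ℝ) ≠ 0 := by positivity
          have hk : 2 * (k : ℝ) + 1 + 1 ≠ 0 := by positivity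
          have hp : 2 * π ≠ 0 := by positivity
          generalize ((2 * k + 1).factorial : ℝ) = f at hf ⊢
          generalize 2 * (k : ℝ) + 1 + 1 = c at hk ⊢
          generalize 2 * π = p at hp ⊢
          rw [div_pow]
          field_simp
          ring
      _ ≤ _ := by gcongr
  refine tendsto_atTop_mono hlow ?_
  have h0 : Tendsto (fun n : ℕ => q ^ n / (n.factorial : ℝ)) atTop (𝓝[>] 0) :=
    tendsto_nhdsWithin_iff.mpr ⟨FloorSemiring.tendsto_pow_div_factorial_atTop q,
      Eventually.of_forall fun n => by simp only [mem_Ioi]; positivity⟩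
  have h1 : Tendsto (fun n : ℕ => (n.factorial : ℝ) / q ^ n) atTop atTop :=
    (tendsto_inv_nhdsGT_zero.comp h0).congr fun n => by simp
  have h2 : Tendsto (fun k : ℕ => 2 * k + 1) atTop atTop :=
    tendsto_atTop_mono (fun k => by simp only [id]; omega) tendsto_id
  exact (h1.comp h2).atTop_div_const (by positivity)

lemma tendsto_sum_coeff_atBot {t : ℝ} (ht : 0 < t) :
    Tendsto (fun N : ℕ => ∑ m ∈ Finset.Icc 1 N, coeff m * (-t) ^ m) atTop atBot := by
  have hanti : Antitone fun N : ℕ => ∑ m ∈ Finset.Icc 1 N, coeff m * (-t) ^ m := by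
    refine antitone_nat_of_succ_le fun N => ?_
    rw [Finset.sum_Icc_succ_top (by omega)]
    linarith [coeff_mul_neg_pow_nonpos ht (m := N + 1) (by omega)]
  refine tendsto_atTop_atBot_of_antitone hanti fun b => ?_
  obtain ⟨k, hk⟩ := ((tendsto_coeff_mul_pow ht).eventually_ge_atTop (-b)).exists
  refine ⟨2 * k + 1, ?_⟩
  rw [Finset.sum_Icc_succ_top (by omega)]
  have h1 : ∑ m ∈ Finset.Icc 1 (2 * k), coeff m * (-t) ^ m ≤ 0 :=
    Finset.sum_nonpos fun m hm => coeff_mul_neg_pow_nonpos ht (Finset.mem_Icc.mp hm).1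
  rw [(odd_two_mul_add_one k).neg_pow]
  linarith

lemma not_tendsto_remainder {t : ℝ} (ht : 0 < t) {κ : ℕ → ℝ} (hκ : Tendsto κ atTop atBot)
    (hκn : ∀ j n : ℕ, κ j ≠ -(n : ℝ)) :
    ¬ Tendsto (fun j => remainder (κ j) t) atTop (𝓝 0) := by
  intro h
  -- The floor numbers the strip between poles that contains κ j, hence the truncation for which the
  -- exact formula holds.
  set N : ℕ → ℕ := fun j => ⌊-κ j⌋₊ with hN
  have hNt : Tendsto N atTop atTop :=
    tendsto_nat_floor_atTop.comp (tendsto_neg_atBot_atTop.comp hκ)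
  have hev : ∀ᶠ j in atTop, (truncation (N j) t : ℂ) = Theta t - remainder (κ j) t := by
    filter_upwards [hκ.eventually_le_atBot 0] with j hj
    have h1 : (N j : ℝ) ≤ -κ j := Nat.floor_le (by linarith)
    have h2 : -κ j < N j + 1 := Nat.lt_floor_add_one _
    have h3 := hκn j (N j)
    rw [Theta_eq_truncation_add_remainder ht (N j) (κ := κ j) (by linarith)
      (lt_of_le_of_ne (by linarith) h3)]
    ring
  have h1 : Tendsto (fun j => (truncation (N j) t : ℂ)) atTop (𝓝 (Theta t - 0)) :=
    (h.const_sub (Theta t : ℂ)).congr' (hev.mono fun j hj => hj.symm)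
  have h2 := (continuous_re.tendsto _).comp h1
  have h3 : Tendsto (fun j => truncation (N j) t) atTop atBot :=
    (tendsto_atBot_add_const_left _ _ (tendsto_sum_coeff_atBot ht)).comp hNt
  exact not_tendsto_nhds_of_tendsto_atBot h3 _ h2

lemma not_tendsto_sum_coeff {z : ℂ} (hz : z ≠ 0) :
    ¬ ∃ S : ℂ, Tendsto
      (fun N : ℕ => ∑ m ∈ Finset.Icc 1 N, (coeff m : ℂ) * (-z) ^ m) atTop (𝓝 S) := by
  rintro ⟨S, hS⟩
  have h1 := ((hS.comp (tendsto_add_atTop_nat 1)).sub hS).norm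
  rw [sub_self, norm_zero] at h1
  have h2 : Tendsto (fun m : ℕ => coeff (m + 1) * ‖z‖ ^ (m + 1)) atTop (𝓝 0) := by
    refine h1.congr fun m => ?_
    simp only [Function.comp_apply]
    rw [Finset.sum_Icc_succ_top (by omega), add_sub_cancel_left, norm_mul, norm_pow, norm_neg,
      Complex.norm_real, Real.norm_of_nonneg (coeff_nonneg _)]
  have h3 : Tendsto (fun k : ℕ => 2 * k) atTop atTop :=
    tendsto_atTop_mono (fun k => by simp only [id]; omega) tendsto_id
  exact not_tendsto_nhds_of_tendsto_atTop (tendsto_coeff_mul_pow (norm_pos_iff.mpr hz)) _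
    (h2.comp h3)

end DirichletGraph

/-! ### Green's formula and the sine modes. -/

namespace DirichletGraph

open Complex MeasureTheory Filter Set intervalIntegral

/-- The primitive of φ is only absolutely continuous, with derivative φ almost everywhere, so
integration by parts is used in its absolutely continuous form. -/
lemma integral_mul_eq_sub_integral_primitive_real {s φ : ℝ → ℝ} (hs : ContDiff ℝ 1 s) {L : ℝ}
    (hφ : IntervalIntegrable φ volume 0 L) :
    ∫ x in (0 : ℝ)..L, s x * φ x =
      s L * (∫ x in (0 : ℝ)..L, φ x) - ∫ x in (0 : ℝ)..L, deriv s x * ∫ y in (0 : ℝ)..x, φ y := by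
  have h1 : AbsolutelyContinuousOnInterval s 0 L :=
    hs.contDiffOn.absolutelyContinuousOnInterval
  have h2 := hφ.absolutelyContinuousOnInterval_intervalIntegral (c := 0) left_mem_uIcc
  have h3 := h1.integral_mul_deriv_eq_deriv_mul h2
  simp only [integral_same, mul_zero, sub_zero] at h3
  rw [← h3]
  refine intervalIntegral.integral_congr_ae ?_
  filter_upwards [hφ.ae_hasDerivAt_integral] with x hx hxm
  rw [(hx (uIoc_subset_uIcc hxm) 0 left_mem_uIcc).deriv]

/-- Integration by parts of a smooth function against an integrable function. -/
lemma integral_mul_eq_sub_integral_primitive {s : ℝ → ℝ} (hs : ContDiff ℝ 1 s) {φ : ℝ → ℂ} {L : ℝ}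
    (hφ : IntervalIntegrable φ volume 0 L) :
    ∫ x in (0 : ℝ)..L, (s x : ℂ) * φ x =
      s L * (∫ x in (0 : ℝ)..L, φ x) -
        ∫ x in (0 : ℝ)..L, ((deriv s x : ℝ) : ℂ) * ∫ y in (0 : ℝ)..x, φ y := by
  have i1 : IntervalIntegrable (fun x => (s x : ℂ) * φ x) volume 0 L :=
    hφ.continuousOn_mul (continuous_ofReal.comp hs.continuous).continuousOn
  have hc : ContinuousOn (fun x => ∫ y in (0 : ℝ)..x, φ y) (uIcc 0 L) :=
    continuousOn_primitive_interval' hφ left_mem_uIcc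
  have i2 : IntervalIntegrable (fun x => ((deriv s x : ℝ) : ℂ) * ∫ y in (0 : ℝ)..x, φ y)
      volume 0 L :=
    ContinuousOn.intervalIntegrable
      ((continuous_ofReal.comp (hs.continuous_deriv le_rfl)).continuousOn.mul hc)
  have hsub : ∀ x ∈ uIcc 0 L, IntervalIntegrable φ volume 0 x := fun x hx =>
    hφ.mono_set (uIcc_subset_uIcc_left hx)
  have key : ∀ ℓ : ℂ →L[ℝ] ℝ, ℓ (∫ x in (0 : ℝ)..L, (s x : ℂ) * φ x) =
      ℓ (s L * (∫ x in (0 : ℝ)..L, φ x) -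
        ∫ x in (0 : ℝ)..L, ((deriv s x : ℝ) : ℂ) * ∫ y in (0 : ℝ)..x, φ y) := by
    intro ℓ
    have hmul : ∀ (r : ℝ) (w : ℂ), ℓ (r * w) = r * ℓ w := fun r w => by
      rw [← real_smul, map_smul, smul_eq_mul]
    rw [map_sub, hmul, ← ℓ.intervalIntegral_comp_comm i1, ← ℓ.intervalIntegral_comp_comm i2,
      ← ℓ.intervalIntegral_comp_comm hφ]
    simp only [hmul]
    rw [integral_mul_eq_sub_integral_primitive_real hs (φ := fun x => ℓ (φ x))
      ⟨ℓ.integrable_comp hφ.1, ℓ.integrable_comp hφ.2⟩]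
    congr 1
    refine intervalIntegral.integral_congr fun x hx => ?_
    rw [ℓ.intervalIntegral_comp_comm (hsub x hx)]
  exact Complex.ext (key reCLM) (key imCLM)

/-- Green's formula on an interval, with Dirichlet boundary conditions. -/
lemma integral_sin_mul_eq {L a : ℝ} (hL : 0 ≤ L) (ha : Real.sin (a * L) = 0) {u v φ : ℝ → ℂ}
    (hφ : IntervalIntegrable φ volume 0 L)
    (hu : ∀ x ∈ Icc 0 L, u x = u 0 + ∫ y in (0 : ℝ)..x, v y)
    (hv : ∀ x ∈ Icc 0 L, v x = v 0 + ∫ y in (0 : ℝ)..x, φ y) (hu0 : u 0 = 0) (huL : u L = 0) :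
    ∫ x in (0 : ℝ)..L, (Real.sin (a * x) : ℂ) * φ x =
      -(a : ℂ) ^ 2 * ∫ x in (0 : ℝ)..L, (Real.sin (a * x) : ℂ) * u x := by
  have huI : uIcc 0 L = Icc 0 L := uIcc_of_le hL
  have dsin : ∀ x, deriv (fun x => Real.sin (a * x)) x = a * Real.cos (a * x) := fun x => by
    have := ((Real.hasDerivAt_sin (a * x)).comp x ((hasDerivAt_id x).const_mul a)).deriv
    simp only [mul_one] at this
    rw [mul_comm]
    exact this
  have dcos : ∀ x, deriv (fun x => Real.cos (a * x)) x = -(a * Real.sin (a * x)) := fun x => by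
    have := ((Real.hasDerivAt_cos (a * x)).comp x ((hasDerivAt_id x).const_mul a)).deriv
    simp only [mul_one] at this
    rw [mul_comm, ← neg_mul]
    exact this
  have hvint : IntervalIntegrable v volume 0 L := by
    refine ContinuousOn.intervalIntegrable ?_
    have hc : ContinuousOn (fun x => v 0 + ∫ y in (0 : ℝ)..x, φ y) (uIcc 0 L) :=
      continuousOn_const.add (continuousOn_primitive_interval' hφ left_mem_uIcc)
    exact hc.congr fun x hx => hv x (huI ▸ hx)
  have e1 := integral_mul_eq_sub_integral_primitive (s := fun x => Real.sin (a * x))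
    (by fun_prop) hφ
  have e2 := integral_mul_eq_sub_integral_primitive (s := fun x => Real.cos (a * x))
    (by fun_prop) hvint
  have hV : ∀ x ∈ uIcc 0 L, ∫ y in (0 : ℝ)..x, φ y = v x - v 0 := fun x hx => by
    rw [hv x (huI ▸ hx)]; ring
  have hU : ∀ x ∈ uIcc 0 L, ∫ y in (0 : ℝ)..x, v y = u x := fun x hx => by
    rw [hu x (huI ▸ hx), hu0, zero_add]
  -- The constant v 0 drops out because the integral of cos(ax) is sin(aL)/a = 0.
  have hcosint : ∫ x in (0 : ℝ)..L, (Real.cos (a * x) : ℂ) * (a * v 0) = 0 := by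
    rw [intervalIntegral.integral_mul_const, intervalIntegral.integral_ofReal]
    rcases eq_or_ne a 0 with rfl | ha0
    · simp
    · rw [intervalIntegral.integral_comp_mul_left (fun x => Real.cos x) ha0, integral_cos]
      simp [ha]
  have icos : IntervalIntegrable (fun x => (Real.cos (a * x) : ℂ) * v x) volume 0 L :=
    hvint.continuousOn_mul (by fun_prop)
  rw [e1, ha]
  simp only [dsin]
  have e3 : ∫ x in (0 : ℝ)..L, ((a * Real.cos (a * x) : ℝ) : ℂ) * ∫ y in (0 : ℝ)..x, φ y =
      a * ∫ x in (0 : ℝ)..L, (Real.cos (a * x) : ℂ) * v x := by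
    rw [← sub_zero (a * ∫ x in (0 : ℝ)..L, (Real.cos (a * x) : ℂ) * v x), ← hcosint,
      ← intervalIntegral.integral_const_mul, ← intervalIntegral.integral_sub]
    · refine intervalIntegral.integral_congr fun x hx => ?_
      rw [hV x hx]
      push_cast
      ring
    · exact icos.const_mul _
    · exact Continuous.intervalIntegrable (by fun_prop) _ _
  rw [e3, e2, hU L right_mem_uIcc, huL]
  simp only [dcos]
  have e4 : ∫ x in (0 : ℝ)..L, ((-(a * Real.sin (a * x)) : ℝ) : ℂ) * ∫ y in (0 : ℝ)..x, v y =
      -a * ∫ x in (0 : ℝ)..L, (Real.sin (a * x) : ℂ) * u x := by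
    rw [← intervalIntegral.integral_const_mul]
    refine intervalIntegral.integral_congr fun x hx => ?_
    rw [hU x hx]
    push_cast
    ring
  rw [e4]
  push_cast
  ring

/-- The length of the edge with number `n`. -/
def edgeLength (n : ℕ+) : ℝ := π / (n : ℝ)

lemma edgeLength_pos (n : ℕ+) : 0 < edgeLength n :=
  div_pos Real.pi_pos (by exact_mod_cast n.pos)

instance isFiniteMeasure_edgeMeasure (n : ℕ+) : IsFiniteMeasure (edgeMeasure n) := by
  unfold edgeMeasure
  infer_instance

lemma edgeMeasure_eq_restrict_Ioc (n : ℕ+) :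
    edgeMeasure n = volume.restrict (Ioc 0 (edgeLength n)) :=
  restrict_Ioc_eq_restrict_Icc.symm

lemma integral_edgeMeasure (n : ℕ+) (f : ℝ → ℂ) :
    ∫ x, f x ∂edgeMeasure n = ∫ x in (0 : ℝ)..edgeLength n, f x := by
  rw [edgeMeasure_eq_restrict_Ioc, intervalIntegral.integral_of_le (edgeLength_pos n).le]

lemma intervalIntegrable_coe_Lp (n : ℕ+) (f : Lp ℂ 2 (edgeMeasure n)) :
    IntervalIntegrable f volume 0 (edgeLength n) := by
  rw [intervalIntegrable_iff_integrableOn_Ioc_of_le (edgeLength_pos n).le, IntegrableOn,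
    ← edgeMeasure_eq_restrict_Ioc]
  exact (Lp.memLp f).integrable one_le_two

lemma sin_freq_mul_edgeLength (n k : ℕ+) :
    Real.sin ((k * n : ℝ) * edgeLength n) = 0 := by
  have : (k * n : ℝ) * edgeLength n = (k : ℕ) * π := by
    have : (n : ℝ) ≠ 0 := by exact_mod_cast n.ne_zero
    simp only [edgeLength]
    field_simp
  rw [this, Real.sin_nat_mul_pi]

/-- The normalized `k`-th Dirichlet eigenfunction of the edge with number `n`. -/
def sineMode (n k : ℕ+) (x : ℝ) : ℂ := (√(2 / edgeLength n) * Real.sin ((k * n : ℝ) * x) : ℝ)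

lemma continuous_sineMode (n k : ℕ+) : Continuous (sineMode n k) := by
  unfold sineMode
  fun_prop

lemma memLp_sineMode (n k : ℕ+) : MemLp (sineMode n k) 2 (edgeMeasure n) := by
  refine MemLp.of_bound (continuous_sineMode n k).aestronglyMeasurable (√(2 / edgeLength n))
    (ae_of_all _ fun x => ?_)
  rw [sineMode, Complex.norm_real, norm_mul, Real.norm_of_nonneg (Real.sqrt_nonneg _)]
  exact mul_le_of_le_one_right (Real.sqrt_nonneg _) (Real.abs_sin_le_one _)

def sineModeLp (n k : ℕ+) : Lp ℂ 2 (edgeMeasure n) := (memLp_sineMode n k).toLp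

lemma coeFn_sineModeLp (n k : ℕ+) : sineModeLp n k =ᵐ[edgeMeasure n] sineMode n k :=
  (memLp_sineMode n k).coeFn_toLp

lemma inner_sineModeLp (n k : ℕ+) (f : Lp ℂ 2 (edgeMeasure n)) :
    inner ℂ (sineModeLp n k) f = √(2 / edgeLength n) *
      ∫ x in (0 : ℝ)..edgeLength n, (Real.sin ((k * n : ℝ) * x) : ℂ) * f x := by
  rw [L2.inner_def, ← integral_edgeMeasure, ← MeasureTheory.integral_const_mul]
  refine integral_congr_ae ?_
  filter_upwards [coeFn_sineModeLp n k] with x hx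
  rw [hx, RCLike.inner_apply, sineMode, conj_ofReal]
  push_cast
  ring

/-- Symmetry of the Laplacian tested on a sine mode. It holds for any ψ in the domain, and it yields
both the orthogonality of the modes and the action on eigenvectors. -/
lemma inner_sineModeLp_of_eigen {ψ φ : GraphL2} (h : IsDirichletLaplacian ψ φ) (n k : ℕ+) :
    inner ℂ (sineModeLp n k) (φ n) =
      -((k * n : ℝ) : ℂ) ^ 2 * inner ℂ (sineModeLp n k) (ψ n) := by
  obtain ⟨u, v, hψ, hu, hv, hu0, huL⟩ := h n
  have hG := integral_sin_mul_eq (edgeLength_pos n).le (sin_freq_mul_edgeLength n k)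
    (intervalIntegrable_coe_Lp n (φ n)) hu hv hu0 huL
  have hψu : ∫ x in (0 : ℝ)..edgeLength n, (Real.sin ((k * n : ℝ) * x) : ℂ) * (ψ n : ℝ → ℂ) x =
      ∫ x in (0 : ℝ)..edgeLength n, (Real.sin ((k * n : ℝ) * x) : ℂ) * u x := by
    rw [← integral_edgeMeasure, ← integral_edgeMeasure]
    refine integral_congr_ae ?_
    filter_upwards [hψ] with x hx
    rw [hx]
  rw [inner_sineModeLp, inner_sineModeLp, hG, hψu]
  ring

/-- The `k`-th eigenfunction on the `n`-th edge, as a function on the graph. -/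
def graphMode (j : ℕ+ × ℕ+) : GraphL2 := lp.single 2 j.1 (sineModeLp j.1 j.2)

lemma inner_graphMode (j : ℕ+ × ℕ+) (f : GraphL2) :
    inner ℂ (graphMode j) f = inner ℂ (sineModeLp j.1 j.2) (f j.1) :=
  lp.inner_single_left _ _ _

lemma isDirichletLaplacian_graphMode (j : ℕ+ × ℕ+) :
    IsDirichletLaplacian (graphMode j)
      (-((((j.2 * j.1 : ℝ) ^ 2 : ℝ) : ℂ) • graphMode j)) := by
  intro m
  obtain ⟨n, k⟩ := j
  rcases eq_or_ne m n with rfl | hmn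
  · have h1 : (graphMode (m, k)) m = sineModeLp m k := lp.single_apply_self _ _ _
    have h2 : (-((((k * m : ℝ) ^ 2 : ℝ) : ℂ) • graphMode (m, k))) m =
        -((((k * m : ℝ) ^ 2 : ℝ) : ℂ) • sineModeLp m k) := by
      rw [← h1]; rfl
    have h3 : ((-((((k * m : ℝ) ^ 2 : ℝ) : ℂ) • sineModeLp m k) : Lp ℂ 2 (edgeMeasure m)) :
        ℝ → ℂ) =ᵐ[edgeMeasure m] fun x => -((((k * m : ℝ) ^ 2 : ℝ) : ℂ) * sineMode m k x) := by
      filter_upwards [Lp.coeFn_neg ((((k * m : ℝ) ^ 2 : ℝ) : ℂ) • sineModeLp m k),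
        Lp.coeFn_smul (((k * m : ℝ) ^ 2 : ℝ) : ℂ) (sineModeLp m k), coeFn_sineModeLp m k]
        with x a1 a2 a3
      rw [a1, Pi.neg_apply, a2, Pi.smul_apply, a3, smul_eq_mul]
    set a : ℝ := k * m with ha
    set c : ℝ := √(2 / edgeLength m) with hc
    have d1 : ∀ x : ℝ, HasDerivAt (sineMode m k) ((c * (a * Real.cos (a * x)) : ℝ) : ℂ) x := by
      intro x
      have := (((Real.hasDerivAt_sin (a * x)).comp x ((hasDerivAt_id x).const_mul a)).const_mul
        c).ofReal_comp
      simp only [mul_one] at this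
      rw [mul_comm a]
      exact this
    have d2 : ∀ x : ℝ, HasDerivAt (fun x : ℝ => ((c * (a * Real.cos (a * x)) : ℝ) : ℂ))
        (-(((a ^ 2 : ℝ) : ℂ) * sineMode m k x)) x := by
      intro x
      have := ((((Real.hasDerivAt_cos (a * x)).comp x ((hasDerivAt_id x).const_mul a)).const_mul
        a).const_mul c).ofReal_comp
      simp only [mul_one] at this
      refine this.congr_deriv ?_
      simp only [sineMode, ← ha, ← hc]
      push_cast
      ring
    refine ⟨sineMode m k, fun x => ((c * (a * Real.cos (a * x)) : ℝ) : ℂ), ?_, ?_, ?_, ?_, ?_⟩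
    · rw [h1]
      exact coeFn_sineModeLp m k
    · intro x _
      rw [intervalIntegral.integral_eq_sub_of_hasDerivAt (fun y _ => d1 y)
        (Continuous.intervalIntegrable (by fun_prop) _ _)]
      ring
    · intro x hx
      have : ∫ y in (0 : ℝ)..x, ((-(((a ^ 2 : ℝ) : ℂ) • graphMode (m, k))) m : ℝ → ℂ) y =
          ∫ y in (0 : ℝ)..x, -(((a ^ 2 : ℝ) : ℂ) * sineMode m k y) := by
        rw [h2, intervalIntegral.integral_of_le hx.1, intervalIntegral.integral_of_le hx.1]
        refine integral_congr_ae ?_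
        refine ae_restrict_of_ae_restrict_of_subset (t := Icc 0 (π / (m : ℝ))) ?_ h3
        exact fun y hy => ⟨hy.1.le, hy.2.trans hx.2⟩
      rw [this, intervalIntegral.integral_eq_sub_of_hasDerivAt (fun y _ => d2 y)
        (Continuous.intervalIntegrable (((continuous_sineMode m k).const_mul _).neg) _ _)]
      ring
    · simp [sineMode]
    · have := sin_freq_mul_edgeLength m k
      rw [edgeLength] at this
      simp [sineMode, this]
  · have h1 : (graphMode (n, k)) m = 0 := lp.single_apply_ne _ _ _ hmn
    have h2 : (-((((k * n : ℝ) ^ 2 : ℝ) : ℂ) • graphMode (n, k))) m = 0 := by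
      have : (-((((k * n : ℝ) ^ 2 : ℝ) : ℂ) • graphMode (n, k))) m =
        -((((k * n : ℝ) ^ 2 : ℝ) : ℂ) • (graphMode (n, k)) m) := rfl
      rw [this, h1, smul_zero, neg_zero]
    refine ⟨0, 0, ?_, by simp, ?_, rfl, rfl⟩
    · rw [h1]
      exact Lp.coeFn_zero _ _ _
    · intro x hx
      have : ∫ y in (0 : ℝ)..x, ((-((((k * n : ℝ) ^ 2 : ℝ) : ℂ) • graphMode (n, k))) m : ℝ → ℂ) y =
          ∫ y in (0 : ℝ)..x, 0 := by
        rw [h2, intervalIntegral.integral_of_le hx.1, intervalIntegral.integral_of_le hx.1]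
        refine integral_congr_ae ?_
        refine ae_restrict_of_ae_restrict_of_subset (t := Icc 0 (π / (m : ℝ))) ?_
          (Lp.coeFn_zero ℂ 2 (edgeMeasure m))
        exact fun y hy => ⟨hy.1.le, hy.2.trans hx.2⟩
      rw [this]
      simp

end DirichletGraph

/-! ### Completeness and orthonormality of the modes. -/

namespace DirichletGraph

open Complex MeasureTheory Filter Set

/-- Completeness of the sine system: a square integrable function on `(0, L]` that is orthogonal
to all sines vanishes almost everywhere. -/
lemma ae_eq_zero_of_integral_sin_eq_zero {L : ℝ} (hL : 0 < L) {f : ℝ → ℂ}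
    (hf : MemLp f 2 (volume.restrict (Ioc 0 L)))
    (h : ∀ k : ℕ, 0 < k → ∫ x in (0 : ℝ)..L, (Real.sin (k * (π / L) * x) : ℂ) * f x = 0) :
    f =ᵐ[volume.restrict (Ioc 0 L)] 0 := by
  set f₀ : ℝ → ℂ := (Ioc 0 L).indicator f with hf₀
  -- The odd extension of f to (-L, L]: its Fourier coefficients are sine integrals of f, so they
  -- all vanish, and Parseval's identity gives g = 0.
  set g : ℝ → ℂ := fun x => f₀ x - f₀ (-x) with hg
  have hf₀2 : MemLp f₀ 2 volume := (memLp_indicator_iff_restrict measurableSet_Ioc).mpr hf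
  have hf₀n : MemLp (fun x => f₀ (-x)) 2 volume :=
    hf₀2.comp_measurePreserving (Measure.measurePreserving_neg volume)
  have hg2 : MemLp g 2 (volume.restrict (Ioc (-L) L)) := (hf₀2.sub hf₀n).restrict _
  have hLL : -L < L := by linarith
  have hint : ∀ a b : ℝ, IntervalIntegrable f₀ volume a b := fun a b =>
    ⟨(hf₀2.restrict _).integrable one_le_two, (hf₀2.restrict _).integrable one_le_two⟩
  have hintn : ∀ a b : ℝ, IntervalIntegrable (fun x => f₀ (-x)) volume a b := fun a b =>
    ⟨(hf₀n.restrict _).integrable one_le_two, (hf₀n.restrict _).integrable one_le_two⟩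
  have hodd : ∀ e : ℝ → ℂ, Continuous e → ∫ x in (-L)..L, e x * g x =
      ∫ x in (0 : ℝ)..L, (e x - e (-x)) * f x := by
    intro e he
    have i1 : IntervalIntegrable (fun x => e x * f₀ x) volume (-L) L :=
      (hint _ _).continuousOn_mul he.continuousOn
    have i2 : IntervalIntegrable (fun x => e x * f₀ (-x)) volume (-L) L :=
      (hintn _ _).continuousOn_mul he.continuousOn
    have i3 : IntervalIntegrable (fun x => e (-x) * f₀ x) volume (-L) L :=
      (hint _ _).continuousOn_mul (by fun_prop)
    have e1 : ∫ x in (-L)..L, e x * f₀ (-x) = ∫ x in (-L)..L, e (-x) * f₀ x := by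
      have := intervalIntegral.integral_comp_neg (a := -L) (b := L) fun x => e x * f₀ (-x)
      simp only [neg_neg] at this
      exact this.symm
    have e2 : ∫ x in (-L)..L, e x * g x = ∫ x in (-L)..L, (e x - e (-x)) * f₀ x := by
      simp only [hg, mul_sub, sub_mul]
      rw [intervalIntegral.integral_sub i1 i2, intervalIntegral.integral_sub i1 i3, e1]
    rw [e2, intervalIntegral.integral_of_le hLL.le, intervalIntegral.integral_of_le hL.le]
    have e3 : (fun x => (e x - e (-x)) * f₀ x) =
        (Ioc 0 L).indicator fun x => (e x - e (-x)) * f x := by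
      ext x
      by_cases hx : x ∈ Ioc 0 L <;> simp [hf₀, hx]
    rw [e3, setIntegral_indicator measurableSet_Ioc,
      inter_eq_right.mpr (Ioc_subset_Ioc_left (by linarith))]
  have hsin : ∀ j : ℤ, ∫ x in (0 : ℝ)..L, (Real.sin (j * (π / L) * x) : ℂ) * f x = 0 := by
    intro j
    rcases lt_trichotomy j 0 with hj | rfl | hj
    · obtain ⟨k, rfl⟩ : ∃ k : ℕ, j = -k := ⟨j.natAbs, by omega⟩
      have := h k (by omega)
      simp only [Int.cast_neg, Int.cast_natCast, neg_mul, Real.sin_neg, ofReal_neg,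
        intervalIntegral.integral_neg, this, neg_zero]
    · simp
    · obtain ⟨k, rfl⟩ : ∃ k : ℕ, j = k := ⟨j.natAbs, by omega⟩
      exact_mod_cast h k (by omega)
  have hcoef : ∀ j : ℤ, fourierCoeffOn hLL g j = 0 := by
    intro j
    rw [fourierCoeffOn_eq_integral]
    have hc : Continuous fun x : ℝ => fourier (-j) (x : AddCircle (L - -L)) :=
      (fourier (-j)).continuous.comp (AddCircle.continuous_mk' _)
    simp only [smul_eq_mul]
    rw [hodd _ hc]
    have e1 : ∀ x : ℝ, fourier (-j) (x : AddCircle (L - -L)) -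
        fourier (-j) ((-x : ℝ) : AddCircle (L - -L)) =
          (-2 * I) * (Real.sin (j * (π / L) * x) : ℂ) := by
      intro x
      rw [fourier_coe_apply, fourier_coe_apply]
      have hL' : (L : ℂ) ≠ 0 := by exact_mod_cast hL.ne'
      have a1 : 2 * π * I * ((-j : ℤ) : ℂ) * x / ((L - -L : ℝ) : ℂ) =
          -((j * (π / L) * x : ℝ) : ℂ) * I := by
        push_cast
        field_simp
        ring
      have a2 : 2 * π * I * ((-j : ℤ) : ℂ) * ((-x : ℝ) : ℂ) / ((L - -L : ℝ) : ℂ) =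
          ((j * (π / L) * x : ℝ) : ℂ) * I := by
        push_cast
        field_simp
        ring
      rw [a1, a2, ofReal_sin, Complex.sin]
      linear_combination (cexp (-((j * (π / L) * x : ℝ) : ℂ) * I) -
        cexp (((j * (π / L) * x : ℝ) : ℂ) * I)) * I_sq
    simp only [e1, mul_assoc (-2 * I)]
    rw [intervalIntegral.integral_const_mul, hsin]
    simp
  have hpars := hasSum_sq_fourierCoeffOn hLL hg2
  simp only [hcoef, norm_zero, ne_eq, OfNat.ofNat_ne_zero, not_false_eq_true, zero_pow] at hpars
  have h0 := hpars.unique hasSum_zero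
  rw [smul_eq_mul, mul_eq_zero, intervalIntegral.integral_of_le hLL.le] at h0
  have h1 : ∫ x in Ioc (-L) L, ‖g x‖ ^ 2 = 0 := h0.resolve_left (by
    rw [inv_eq_zero]
    linarith)
  rw [integral_eq_zero_iff_of_nonneg (fun x => by positivity) hg2.integrable_norm_pow'] at h1
  have h2 := ae_restrict_of_ae_restrict_of_subset
    (Ioc_subset_Ioc_left (by linarith) : Ioc 0 L ⊆ Ioc (-L) L) h1
  filter_upwards [h2, ae_restrict_mem measurableSet_Ioc] with x hx hxm
  have hgx : g x = 0 := by simpa using hx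
  have hn : -x ∉ Ioc 0 L := fun hh => by
    have := hh.1
    have := hxm.1
    linarith
  simpa [hg, hf₀, hxm, hn] using hgx

lemma eq_zero_of_inner_sineModeLp {n : ℕ+} {f : Lp ℂ 2 (edgeMeasure n)}
    (h : ∀ k, inner ℂ (sineModeLp n k) f = 0) : f = 0 := by
  have hf : MemLp f 2 (volume.restrict (Ioc 0 (edgeLength n))) := by
    rw [← edgeMeasure_eq_restrict_Ioc]
    exact Lp.memLp f
  have hL := edgeLength_pos n
  have key := ae_eq_zero_of_integral_sin_eq_zero hL hf fun k hk => by
    have h1 := (inner_sineModeLp n ⟨k, hk⟩ f).symm.trans (h ⟨k, hk⟩)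
    rw [mul_eq_zero] at h1
    have h2 := h1.resolve_left (by
      rw [ofReal_eq_zero]
      exact (Real.sqrt_pos.mpr (by positivity)).ne')
    have h3 : (k : ℝ) * (π / edgeLength n) = k * n := by
      have : (n : ℝ) ≠ 0 := by exact_mod_cast n.ne_zero
      have := Real.pi_ne_zero
      simp only [edgeLength]
      field_simp
    rw [h3]
    exact h2
  rw [← edgeMeasure_eq_restrict_Ioc] at key
  exact Lp.ext (key.trans (Lp.coeFn_zero _ _ _).symm)

lemma inner_sineModeLp_self (n k : ℕ+) : inner ℂ (sineModeLp n k) (sineModeLp n k) = (1 : ℂ) := by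
  have hL := edgeLength_pos n
  have ha : (k * n : ℝ) ≠ 0 := by
    have h1 : (k : ℝ) ≠ 0 := by exact_mod_cast k.ne_zero
    have h2 : (n : ℝ) ≠ 0 := by exact_mod_cast n.ne_zero
    exact mul_ne_zero h1 h2
  rw [inner_sineModeLp, ← integral_edgeMeasure]
  have e1 : ∫ x, (Real.sin ((k * n : ℝ) * x) : ℂ) * (sineModeLp n k : ℝ → ℂ) x ∂edgeMeasure n =
      ∫ x, ((√(2 / edgeLength n) * Real.sin ((k * n : ℝ) * x) ^ 2 : ℝ) : ℂ) ∂edgeMeasure n := by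
    refine integral_congr_ae ?_
    filter_upwards [coeFn_sineModeLp n k] with x hx
    rw [hx, sineMode]
    push_cast
    ring
  have e2 : ∫ x in (0 : ℝ)..edgeLength n, Real.sin ((k * n : ℝ) * x) ^ 2 = edgeLength n / 2 := by
    rw [intervalIntegral.integral_comp_mul_left (fun x => Real.sin x ^ 2) ha, integral_sin_sq,
      sin_freq_mul_edgeLength]
    simp only [mul_zero, Real.sin_zero, zero_mul, sub_zero, smul_eq_mul, zero_add]
    field_simp
  rw [e1, integral_edgeMeasure, intervalIntegral.integral_ofReal,
    intervalIntegral.integral_const_mul, e2, ← ofReal_mul, ← mul_assoc,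
    Real.mul_self_sqrt (by positivity)]
  norm_cast
  field_simp

/-- Symmetry makes eigenvectors with distinct eigenvalues (ln)² and (kn)² orthogonal; no
trigonometric integral is needed. -/
lemma inner_sineModeLp_of_ne {n k l : ℕ+} (hkl : k ≠ l) :
    inner ℂ (sineModeLp n k) (sineModeLp n l) = (0 : ℂ) := by
  have h := inner_sineModeLp_of_eigen (isDirichletLaplacian_graphMode (n, l)) n k
  have h1 : (graphMode (n, l)) n = sineModeLp n l := lp.single_apply_self _ _ _
  have h2 : (-((((l * n : ℝ) ^ 2 : ℝ) : ℂ) • graphMode (n, l))) n =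
      -((((l * n : ℝ) ^ 2 : ℝ) : ℂ) • sineModeLp n l) := by
    rw [← h1]; rfl
  simp only at h
  rw [h1, h2, inner_neg_right, inner_smul_right] at h
  have h3 : ((((l * n : ℝ) ^ 2 : ℝ) : ℂ) - ((k * n : ℝ) : ℂ) ^ 2) *
      inner ℂ (sineModeLp n k) (sineModeLp n l) = 0 := by linear_combination -h
  refine (mul_eq_zero.mp h3).resolve_left fun h4 => hkl ?_
  have h5 : (l * n : ℝ) ^ 2 = (k * n : ℝ) ^ 2 := by
    have := sub_eq_zero.mp h4
    exact_mod_cast this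
  have h6 : (l * n : ℝ) = k * n := by
    rwa [sq_eq_sq₀ (by positivity) (by positivity)] at h5
  have h7 : (n : ℝ) ≠ 0 := by exact_mod_cast n.ne_zero
  have h8 : (l : ℝ) = k := mul_right_cancel₀ h7 h6
  exact (by exact_mod_cast h8 : l = k).symm

lemma orthonormal_graphMode : Orthonormal ℂ graphMode := by
  rw [orthonormal_iff_ite]
  rintro ⟨n, k⟩ ⟨m, l⟩
  rw [inner_graphMode]
  simp only
  rcases eq_or_ne n m with rfl | hnm
  · have h1 : (graphMode (n, l)) n = sineModeLp n l := lp.single_apply_self _ _ _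
    rw [h1]
    rcases eq_or_ne k l with rfl | hkl
    · rw [inner_sineModeLp_self, if_pos rfl]
    · simp [inner_sineModeLp_of_ne hkl, hkl]
  · have h1 : (graphMode (m, l)) n = 0 := lp.single_apply_ne _ _ _ hnm
    rw [h1, inner_zero_right, if_neg]
    intro h
    exact hnm (congrArg Prod.fst h)

lemma span_graphMode_orthogonal : (Submodule.span ℂ (range graphMode))ᗮ = ⊥ := by
  rw [Submodule.eq_bot_iff]
  intro f hf
  rw [Submodule.mem_orthogonal] at hf
  ext1
  ext1 n
  refine eq_zero_of_inner_sineModeLp fun k => ?_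
  have := hf (graphMode (n, k)) (Submodule.subset_span (mem_range_self _))
  rwa [inner_graphMode] at this

/-- The Hilbert basis of Dirichlet eigenfunctions of the graph. -/
def graphBasis : HilbertBasis (ℕ+ × ℕ+) ℂ GraphL2 :=
  HilbertBasis.mkOfOrthogonalEqBot orthonormal_graphMode span_graphMode_orthogonal

lemma graphBasis_apply (j : ℕ+ × ℕ+) : graphBasis j = graphMode j := by
  simp [graphBasis]

/-! ### Diagonal operators and the basis independence of their trace. -/

section Diagonal

variable {J E : Type*} [NormedAddCommGroup E] [InnerProductSpace ℂ E] [CompleteSpace E]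

/-- The operator that is diagonal in the Hilbert basis `b`, with summable eigenvalues `μ`. -/
def diagonalOperator (b : HilbertBasis J ℂ E) (μ : J → ℝ) : E →L[ℂ] E :=
  ∑' j, (μ j : ℂ) • (innerSL ℂ (b j)).smulRight (b j)

lemma hasSum_diagonalOperator (b : HilbertBasis J ℂ E) {μ : J → ℝ} (hμ : Summable μ)
    (x : E) : HasSum (fun j => (μ j : ℂ) • (inner ℂ (b j) x • b j)) (diagonalOperator b μ x) := by
  have hs : Summable fun j => (μ j : ℂ) • (innerSL ℂ (b j)).smulRight (b j) := by
    refine Summable.of_norm_bounded hμ.abs fun j => ?_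
    rw [norm_smul, ContinuousLinearMap.norm_smulRight_apply, innerSL_apply_norm,
      b.orthonormal.1 j]
    simp
  exact hs.hasSum.mapL (ContinuousLinearMap.apply ℂ E x)

lemma diagonalOperator_apply_basis (b : HilbertBasis J ℂ E) {μ : J → ℝ} (hμ : Summable μ)
    (j : J) : diagonalOperator b μ (b j) = (μ j : ℂ) • b j := by
  classical
  have h := hasSum_diagonalOperator b hμ (b j)
  refine h.unique ?_
  have h2 := hasSum_single (f := fun i => (μ i : ℂ) • (inner ℂ (b i) (b j) • b i)) j
    fun i hi => by simp [orthonormal_iff_ite.mp b.orthonormal i j, hi]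
  have hj : inner ℂ (b j) (b j) = (1 : ℂ) :=
    inner_self_eq_one_of_norm_eq_one (b.orthonormal.1 j)
  simp only [hj, one_smul] at h2
  exact h2

/-- The trace of a diagonal operator with nonnegative eigenvalues can be computed in any Hilbert
basis. -/
lemma hasSum_inner_diagonalOperator (b : HilbertBasis J ℂ E) {μ : J → ℝ} (hμ : Summable μ)
    (hμ0 : ∀ j, 0 ≤ μ j) {ι : Type*} (c : HilbertBasis ι ℂ E) :
    HasSum (fun i => inner ℂ (c i) (diagonalOperator b μ (c i))) ((∑' j, μ j : ℝ) : ℂ) := by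
  -- Parseval for the unit vector `b j` in the basis `c`. The double family is nonnegative, so it
  -- may be summed by columns to ∑ μ j or by rows to the trace in `c`.
  have hcol : ∀ j, HasSum (fun i => μ j * ‖(inner ℂ (c i) (b j) : ℂ)‖ ^ 2) (μ j) := by
    intro j
    have h := c.hasSum_inner_mul_inner (b j) (b j)
    have e : ∀ i, inner ℂ (b j) (c i) * inner ℂ (c i) (b j) =
        ((‖(inner ℂ (c i) (b j) : ℂ)‖ ^ 2 : ℝ) : ℂ) := fun i => by
      rw [← inner_conj_symm (b j) (c i), ← Complex.normSq_eq_conj_mul_self,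
        Complex.normSq_eq_norm_sq]
    simp only [e] at h
    rw [inner_self_eq_one_of_norm_eq_one (b.orthonormal.1 j)] at h
    have h2 : HasSum (fun i => ‖(inner ℂ (c i) (b j) : ℂ)‖ ^ 2) 1 := by
      rw [← hasSum_ofReal, ofReal_one]
      exact h
    simpa using h2.mul_left (μ j)
  have hsum : Summable fun p : J × ι => μ p.1 * ‖(inner ℂ (c p.2) (b p.1) : ℂ)‖ ^ 2 := by
    refine (summable_prod_of_nonneg fun p => mul_nonneg (hμ0 _) (by positivity)).mpr
      ⟨fun j => (hcol j).summable, ?_⟩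
    simpa only [(hcol _).tsum_eq] using hμ
  have htot : HasSum (fun p : J × ι => μ p.1 * ‖(inner ℂ (c p.2) (b p.1) : ℂ)‖ ^ 2)
      (∑' j, μ j) := by
    have := hsum.hasSum.prod_fiberwise hcol
    rw [this.tsum_eq]
    exact hsum.hasSum
  have hrow : ∀ i, HasSum (fun j => ((μ j * ‖(inner ℂ (c i) (b j) : ℂ)‖ ^ 2 : ℝ) : ℂ))
      (inner ℂ (c i) (diagonalOperator b μ (c i))) := by
    intro i
    have h := (hasSum_diagonalOperator b hμ (c i)).mapL (innerSL ℂ (c i))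
    have e : ∀ j, innerSL ℂ (c i) ((μ j : ℂ) • (inner ℂ (b j) (c i) • b j)) =
        ((μ j * ‖(inner ℂ (c i) (b j) : ℂ)‖ ^ 2 : ℝ) : ℂ) := fun j => by
      rw [innerSL_apply_apply, inner_smul_right, inner_smul_right, ← inner_conj_symm (b j) (c i),
        ← Complex.normSq_eq_conj_mul_self, Complex.normSq_eq_norm_sq, ofReal_mul]
    simp only [e] at h
    exact h
  exact (hasSum_ofReal.mpr ((Equiv.prodComm ι J).hasSum_iff.mpr htot)).prod_fiberwise hrow

end Diagonal

/-! ### The wave operator and its trace. -/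

/-- The eigenvalues of the wave operator. -/
def waveEigenvalue (t : ℝ) (j : ℕ+ × ℕ+) : ℝ := Real.exp (-t * (j.2 * j.1 : ℝ))

lemma hasSum_waveEigenvalue {t : ℝ} (ht : 0 < t) : HasSum (waveEigenvalue t) (Theta t) := by
  have hr : ‖Real.exp (-t)‖ < 1 := by
    rw [Real.norm_of_nonneg (Real.exp_pos _).le, Real.exp_lt_one_iff]
    linarith
  have e1 : waveEigenvalue t = fun c : ℕ+ × ℕ+ =>
      (c.2 : ℝ) ^ 0 * (Real.exp (-t) ^ (c.1 * c.2 : ℕ)) := by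
    ext c
    rw [waveEigenvalue, ← Real.exp_nat_mul, pow_zero, one_mul]
    congr 1
    push_cast
    ring
  have hs : Summable (waveEigenvalue t) := by
    rw [e1]
    exact summable_prod_mul_pow 0 hr
  -- The exponent 0 selects σ₀, the divisor function, when pairs are grouped by product.
  have h1 := tsum_prod_pow_eq_tsum_sigma 0 hr
  rw [hs.hasSum_iff, e1, (summable_prod_mul_pow 0 hr).tsum_prod, h1, Theta]
  have h2 := tsum_zero_pnat_eq_tsum_nat (summable_card_divisors_mul_exp ht)
  rw [← h2]
  simp only [Nat.divisors_zero, Finset.card_empty, Nat.cast_zero, zero_mul, zero_add]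
  refine tsum_congr fun n => ?_
  rw [ArithmeticFunction.sigma_zero_apply, ← Real.exp_nat_mul]
  congr 2
  ring

/-- The operator `exp (-t √(-Δ))`. -/
def waveOperator (t : ℝ) : GraphL2 →L[ℂ] GraphL2 := diagonalOperator graphBasis (waveEigenvalue t)

lemma isWaveOperator_waveOperator {t : ℝ} (ht : 0 < t) : IsWaveOperator t (waveOperator t) := by
  intro E ψ hψ
  have h1 := hasSum_diagonalOperator graphBasis (hasSum_waveEigenvalue ht).summable ψ
  have h2 := (graphBasis.hasSum_repr ψ).const_smul (Real.exp (-t * √E) : ℂ)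
  refine h1.unique ?_
  convert h2 using 2 with j
  rw [HilbertBasis.repr_apply_apply, graphBasis_apply, smul_smul, smul_smul]
  congr 1
  have h3 := inner_sineModeLp_of_eigen hψ j.1 j.2
  have h4 : (-((E : ℂ) • ψ)) j.1 = -((E : ℂ) • ψ j.1) := rfl
  rw [h4, inner_neg_right, inner_smul_right, ← inner_graphMode] at h3
  have h5 : ((E : ℂ) - ((j.2 * j.1 : ℝ) : ℂ) ^ 2) * inner ℂ (graphMode j) ψ = 0 := by
    linear_combination -h3
  -- Either the mode has eigenvalue E, or ψ has no component along it. For E outside the spectrum,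
  -- negative E included, only the second case occurs, and the value of √E is immaterial.
  rcases mul_eq_zero.mp h5 with h6 | h6
  · have h7 : E = (j.2 * j.1 : ℝ) ^ 2 := by
      have := sub_eq_zero.mp h6
      exact_mod_cast this
    rw [h7, Real.sqrt_sq (by positivity), waveEigenvalue]
  · rw [h6, mul_zero, mul_zero]

/-- Uniqueness: the modes are eigenvectors, so T is prescribed on a set with dense span, and T is
continuous. -/
lemma isWaveOperator_iff {t : ℝ} (ht : 0 < t) (T : GraphL2 →L[ℂ] GraphL2) :
    IsWaveOperator t T ↔ T = waveOperator t := by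
  refine ⟨fun hT => ?_, fun h => h ▸ isWaveOperator_waveOperator ht⟩
  refine ContinuousLinearMap.ext_on
    (Submodule.dense_iff_topologicalClosure_eq_top.mpr graphBasis.dense_span) ?_
  rintro _ ⟨j, rfl⟩
  rw [waveOperator, diagonalOperator_apply_basis _ (hasSum_waveEigenvalue ht).summable,
    graphBasis_apply, hT _ _ (isDirichletLaplacian_graphMode j), waveEigenvalue,
    Real.sqrt_sq (by positivity)]

lemma hasTrace_waveOperator {t : ℝ} (ht : 0 < t) : HasTrace (waveOperator t) (Theta t : ℂ) := by
  intro ι b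
  have h := hasSum_waveEigenvalue ht
  rw [← h.tsum_eq]
  exact hasSum_inner_diagonalOperator graphBasis h.summable (fun j => (Real.exp_pos _).le) b

end DirichletGraph

end

theorem theorem3 :
    -- `Θ(t)` is a convergent series, and it is the trace of the wave operator
    (∀ t : ℝ, 0 < t →
      Summable (fun n : ℕ => (n.divisors.card : ℝ) * Real.exp (-(n : ℝ) * t)) ∧
      ∃ T : DirichletGraph.GraphL2 →L[ℂ] DirichletGraph.GraphL2,
        (∀ T' : DirichletGraph.GraphL2 →L[ℂ] DirichletGraph.GraphL2,
          DirichletGraph.IsWaveOperator t T' ↔ T' = T) ∧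
        DirichletGraph.HasTrace T (DirichletGraph.Theta t : ℂ)) ∧
    -- the asymptotic expansion as `t → 0⁺`
    (∀ N : ℕ,
      (fun t : ℝ => DirichletGraph.Theta t - DirichletGraph.truncation N t)
        =o[𝓝[>] (0 : ℝ)] (fun t : ℝ => t ^ N)) ∧
    -- the exact formula, with an absolutely convergent remainder integral
    (∀ (N : ℕ) (κ t : ℝ), 1 ≤ N → -(N : ℝ) - 1 < κ → κ < -(N : ℝ) → 0 < t →
      Complex.VerticalIntegrable DirichletGraph.mellinDensity κ ∧
      (DirichletGraph.Theta t : ℂ) =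
        (DirichletGraph.truncation N t : ℂ) + DirichletGraph.remainder κ t) ∧
    -- the remainder does not tend to zero as the contour moves to `-∞` off the poles
    (∀ t : ℝ, 0 < t → ∀ κ : ℕ → ℝ,
      Filter.Tendsto κ Filter.atTop Filter.atBot →
      (∀ j n : ℕ, κ j ≠ -(n : ℝ)) →
      ¬ Filter.Tendsto (fun j => DirichletGraph.remainder (κ j) t) Filter.atTop (𝓝 0)) ∧
    -- the power series has radius of convergence zero: it diverges at every nonzero point
    (∀ z : ℂ, z ≠ 0 →
      ¬ ∃ S : ℂ, Filter.Tendsto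
        (fun N : ℕ => ∑ m ∈ Finset.Icc 1 N, (DirichletGraph.coeff m : ℂ) * (-z) ^ m)
        Filter.atTop (𝓝 S)) := by
  refine ⟨fun t ht => ⟨DirichletGraph.summable_card_divisors_mul_exp ht,
      DirichletGraph.waveOperator t, DirichletGraph.isWaveOperator_iff ht,
      DirichletGraph.hasTrace_waveOperator ht⟩,
    DirichletGraph.Theta_sub_truncation_isLittleO, fun N κ t hN h1 h2 ht => ⟨?_, ?_⟩,
    fun t ht κ hκ hκn => DirichletGraph.not_tendsto_remainder ht hκ hκn,
    fun z hz => DirichletGraph.not_tendsto_sum_coeff hz⟩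
  · have hN0 : (1 : ℝ) ≤ N := by exact_mod_cast hN
    refine DirichletGraph.verticalIntegrable_mellinDensity (by linarith) fun n hn => ?_
    have k1 : (n : ℝ) < N + 1 := by linarith
    have k2 : (N : ℝ) < n := by linarith
    have k1' : n < N + 1 := by exact_mod_cast k1
    have k2' : N < n := by exact_mod_cast k2
    omega
  · exact DirichletGraph.Theta_eq_truncation_add_remainder ht N h1 h2
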